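/- **Setting.** Let $\gamma:[0,T]\to\mathbb{R}^d$ be a continuous path of bounded variation, with length $\ell(\gamma)$ (its total $1$-variation on $[0,T]$ for the Euclidean norm). For a word $w=w_1\cdots w_k$ in the letters $1,\dots,d$ and $0\le s\le t\le T$ let $$S^w_{s,t}(\gamma)=\int_{s\le t_1\le\cdots\le t_k\le t}d\gamma^{w_1}_{t_1}\cdots d\gamma^{w_k}_{t_k},\qquad S^{\varnothing}_{s,t}(\gamma)=1 .$$ Let $\tau:\mathbb{C}\langle X_1,\dots,X_d\rangle\to\mathbb{C}$ be the law of $d$ freely independent standard (variance $1$) semicircular variables, write $X_w=X_{w_1}\cdots X_{w_k}$, and let $$\langle\gamma_{s,t}\rangle=\sum_{w}i^{|w|}\,\tau(X_w)\,S^w_{s,t}(\gamma),$$ the sum being over all words, including the empty one. For $n,m\ge 1$, the random Pauli ensemble with $m$ strings on $n$ qubits is the law of the $2^n\times2^n$ Hermitian matrix $$\frac1{\sqrt m}\sum_{j=1}^m r_j\,\sigma_j(1)\otimes\cdots\otimes\sigma_j(n),$$ where all $r_j$ are uniform on $\{-1,1\}$, all $\sigma_j(k)$ are uniform on the four Pauli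 matrices $\{\sigma_I,\sigma_X,\sigma_Y,\sigma_Z\}$, and all of these are independent. Let $A_1,\dots,A_d$ be i.i.d. matrices from this ensemble, let $U_{s,\cdot}$ be the solution on $[s,T]$ of $$dU_{s,t}=i\sum_{\nu=1}^d U_{s,t}A_\nu\,d\gamma^\nu_t,\qquad U_{s,s}=I,$$ and let $\operatorname{tr}=2^{-n}\operatorname{Tr}$ be the normalised trace. **Theorem.** The series defining $\langle\gamma_{s,t}\rangle$ converges absolutely, and the equation for $U_{s,\cdot}$ has exactly one continuous solution on $[s,T]$. There is a constant $C=C(d,\ell(\gamma))>0$, depending only on $d$ and on the length of $\gamma$, such that for all $n\ge1$, $m\ge1$ and $0\le s\le t\le T$ $$\mathbb{E}\Big[\big|\operatorname{tr}U_{s,t}-\langle\gamma_{s,t}\rangle\big|^2\Big]<C\,\big(m^{-1}+4^{-n}\big).$$ -/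

import Mathlib

open MeasureTheory ProbabilityTheory

noncomputable section

/-! ### Paths of bounded variation, Stieltjes integrals, signatures -/

/-- Continuous paths `γ : [0,T] → ℝ^d` of bounded variation (only the values on `[0,T]` matter),
for the Euclidean norm on `ℝ^d`. -/
structure BVPath (d : ℕ) (T : ℝ) where
  toFun : ℝ → EuclideanSpace ℝ (Fin d)
  T_nonneg : 0 ≤ T
  continuousOn : ContinuousOn toFun (Set.Icc 0 T)
  boundedVariationOn : BoundedVariationOn toFun (Set.Icc 0 T)

namespace BVPath

variable {d : ℕ} {T : ℝ}

/-- The length (total `1`-variation) of the path. -/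
def length (γ : BVPath d T) : ℝ := (eVariationOn γ.toFun (Set.Icc 0 T)).toReal

/-- The `j`-th coordinate of the path, extended from `[0,T]` to `ℝ` by its end values. -/
def coord (γ : BVPath d T) (j : Fin d) (u : ℝ) : ℝ := γ.toFun (max 0 (min u T)) j

theorem coord_boundedVariationOn (γ : BVPath d T) (j : Fin d) :
    BoundedVariationOn (γ.coord j) Set.univ := by
  have hlip : LipschitzWith 1 (fun x : EuclideanSpace ℝ (Fin d) => x j) := by
    refine LipschitzWith.of_dist_le_mul fun x y => ?_
    have h := PiLp.norm_apply_le (x - y) j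
    simpa [dist_eq_norm] using h
  have h1 : BoundedVariationOn (fun u => γ.toFun u j) (Set.Icc 0 T) :=
    hlip.comp_boundedVariationOn γ.boundedVariationOn
  have hmaps : Set.MapsTo (fun u : ℝ => max 0 (min u T)) Set.univ (Set.Icc 0 T) :=
    fun u _ => ⟨le_max_left _ _, max_le γ.T_nonneg (min_le_right _ _)⟩
  have hmono : MonotoneOn (fun u : ℝ => max 0 (min u T)) Set.univ :=
    fun a _ b _ hab => max_le_max le_rfl (min_le_min hab le_rfl)
  exact ((eVariationOn.comp_le_of_monotoneOn (fun u => γ.toFun u j) _ hmono hmaps).trans_lt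
    h1.lt_top).ne

/-- The signed Lebesgue-Stieltjes measure `dγ^j`. -/
def dcoord (γ : BVPath d T) (j : Fin d) : SignedMeasure ℝ :=
  (γ.coord_boundedVariationOn j).vectorMeasure

/-- Iterated integrals indexed by the reversed word:
`sigRev γ s (j :: w) t = ∫_s^t sigRev γ s w u dγ^j_u`. -/
def sigRev (γ : BVPath d T) (s : ℝ) : List (Fin d) → ℝ → ℝ
  | [], _ => 1
  | j :: w, t => ∫ᵛ u in Set.Ioc s t, sigRev γ s w u ∂<•(γ.dcoord j)

/-- The signature coordinate
`S^w_{s,t}(γ) = ∫_{s ≤ t_1 ≤ ⋯ ≤ t_k ≤ t} dγ^{w_1}_{t_1} ⋯ dγ^{w_k}_{t_k}`;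
the last letter of the word belongs to the outermost integral. -/
def sig (γ : BVPath d T) (w : List (Fin d)) (s t : ℝ) : ℝ := γ.sigRev s w.reverse t

/-- `U` solves `dU_{s,t} = i ∑_j U_{s,t} A_j dγ^j_t`, `U_{s,s} = I`, for `t ∈ [s,T]`
(in integrated form, entry by entry). -/
structure IsDevelopment {ι : Type*} [Fintype ι] [DecidableEq ι] (γ : BVPath d T)
    (A : Fin d → Matrix ι ι ℂ) (s : ℝ) (U : ℝ → Matrix ι ι ℂ) : Prop where
  continuousOn : ContinuousOn U (Set.Icc s T)
  eq : ∀ t ∈ Set.Icc s T, ∀ a b, U t a b = (1 : Matrix ι ι ℂ) a b +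
    Complex.I * ∑ j, ∫ᵛ u in Set.Ioc s t, (U u * A j) a b ∂<•(γ.dcoord j)

end BVPath

/-! ### The law of `d` free semicircular variables -/

/-- Full Fock space of `ℂ^d` (algebraic version): finite combinations of the orthonormal basis
`e_w` indexed by words. The empty word is the vacuum. -/
abbrev Fock (d : ℕ) : Type := List (Fin d) →₀ ℂ

/-- `ℓ_i + ℓ_i^*`: left creation `e_w ↦ e_{iw}` plus its adjoint (left annihilation). -/
def fockField (d : ℕ) (i : Fin d) : Module.End ℂ (Fock d) :=
  Finsupp.lmapDomain ℂ ℂ (List.cons i) +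
    Finsupp.lcomapDomain (List.cons i) (List.cons_injective (a := i))

/-- The non-commutative law `τ` of `d` free standard semicircular variables: the vacuum state
`τ(P) = ⟨e_∅, P(ℓ_1 + ℓ_1^*, …, ℓ_d + ℓ_d^*) e_∅⟩` on `ℂ⟨X_1, …, X_d⟩`. -/
def freeSemicircularLaw (d : ℕ) : FreeAlgebra ℂ (Fin d) →ₗ[ℂ] ℂ :=
  Finsupp.lapply [] ∘ₗ LinearMap.applyₗ (Finsupp.single [] 1) ∘ₗ
    (FreeAlgebra.lift ℂ (fockField d)).toLinearMap

/-- `τ` is the law of freely independent standard semicircular variables: `τ(1) = 1`; each `X_i`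
has the moments of the semicircle distribution of variance `1` (Catalan numbers in even degree,
zero in odd degree); alternating products of centred polynomials in single variables are centred. -/
structure IsFreeSemicircularLaw {d : ℕ} (τ : FreeAlgebra ℂ (Fin d) →ₗ[ℂ] ℂ) : Prop where
  mass : τ 1 = 1
  even_moment : ∀ i p, τ (FreeAlgebra.ι ℂ i ^ (2 * p)) = catalan p
  odd_moment : ∀ i p, τ (FreeAlgebra.ι ℂ i ^ (2 * p + 1)) = 0
  free : ∀ L : List (Fin d × Polynomial ℂ), L ≠ [] →
    L.IsChain (fun a b => a.1 ≠ b.1) →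
    (∀ a ∈ L, τ (Polynomial.aeval (FreeAlgebra.ι ℂ a.1) a.2) = 0) →
    τ (L.map fun a => Polynomial.aeval (FreeAlgebra.ι ℂ a.1) a.2).prod = 0

/-- One-letter version of `fockField`, on combinations of `e_0, e_1, …`. -/
def chainField : Module.End ℂ (ℕ →₀ ℂ) :=
  Finsupp.lmapDomain ℂ ℂ Nat.succ +
    (Finsupp.lcomapDomain Nat.succ Nat.succ_injective : (ℕ →₀ ℂ) →ₗ[ℂ] ℕ →₀ ℂ)

/-- Embedding `e_n ↦ e_{i^n v}`. -/
def chainEmb {d : ℕ} (i : Fin d) (v : List (Fin d)) : (ℕ →₀ ℂ) →ₗ[ℂ] Fock d :=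
  Finsupp.lmapDomain ℂ ℂ fun n => List.replicate n i ++ v

theorem fockField_chainEmb {d : ℕ} (i : Fin d) (v : List (Fin d)) (hv : v.head? ≠ some i)
    (x : ℕ →₀ ℂ) : fockField d i (chainEmb i v x) = chainEmb i v (chainField x) := by
  induction x using Finsupp.induction_linear with
  | zero => simp
  | add x y hx hy => simp only [map_add, hx, hy]
  | single n c =>
    have h1 : Finsupp.lcomapDomain (R := ℂ) (List.cons i) (List.cons_injective (a := i))
        (Finsupp.single (List.replicate n i ++ v) c) =
        chainEmb i v (Finsupp.lcomapDomain (R := ℂ) Nat.succ Nat.succ_injective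
          (Finsupp.single n c)) := by
      cases n with
      | zero =>
        have h2 : Finsupp.lcomapDomain (R := ℂ) Nat.succ Nat.succ_injective
            (Finsupp.single 0 c) = 0 := by
          ext k; simp [Finsupp.lcomapDomain]
        rw [h2, map_zero]
        ext w
        simp only [Finsupp.lcomapDomain, LinearMap.coe_mk, AddHom.coe_mk,
          Finsupp.comapDomain_apply, List.replicate_zero, List.nil_append, Finsupp.coe_zero,
          Pi.zero_apply]
        rw [Finsupp.single_apply, if_neg]
        rintro rfl
        exact hv rfl
      | succ n =>
        have h2 : Finsupp.lcomapDomain (R := ℂ) Nat.succ Nat.succ_injective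
            (Finsupp.single (n + 1) c) = Finsupp.single n c := by
          ext k; simp [Finsupp.lcomapDomain, Finsupp.single_apply]
        rw [h2]
        ext w
        simp [chainEmb, Finsupp.lcomapDomain, Finsupp.single_apply,
          List.replicate_succ, Finsupp.mapDomain_single]
    have h0 : chainEmb i v (Finsupp.single n c) = Finsupp.single (List.replicate n i ++ v) c := by
      simp [chainEmb, Finsupp.mapDomain_single]
    rw [h0, fockField, chainField, LinearMap.add_apply, LinearMap.add_apply, h1, map_add]
    simp [chainEmb, Finsupp.mapDomain_single, List.replicate_succ]

theorem aeval_fockField_chainEmb {d : ℕ} (i : Fin d) (v : List (Fin d)) (hv : v.head? ≠ some i)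
    (p : Polynomial ℂ) : ∀ x : ℕ →₀ ℂ,
    Polynomial.aeval (fockField d i) p (chainEmb i v x) =
      chainEmb i v (Polynomial.aeval chainField p x) := by
  induction p using Polynomial.induction_on with
  | C a => intro x; simp [Module.algebraMap_end_apply]
  | add p q hp hq => intro x; simp only [map_add, LinearMap.add_apply, hp, hq]
  | monomial n a h =>
    intro x
    rw [pow_succ, ← mul_assoc, map_mul _ (_ * _), map_mul _ (_ * _), Polynomial.aeval_X,
      Polynomial.aeval_X, Module.End.mul_apply, Module.End.mul_apply,
      fockField_chainEmb i v hv, h]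

theorem freeSemicircularLaw_apply {d : ℕ} (P : FreeAlgebra ℂ (Fin d)) :
    freeSemicircularLaw d P =
      FreeAlgebra.lift ℂ (fockField d) P (Finsupp.single [] 1) [] := rfl

theorem lift_aeval_ι {d : ℕ} (i : Fin d) (p : Polynomial ℂ) :
    FreeAlgebra.lift ℂ (fockField d) (Polynomial.aeval (FreeAlgebra.ι ℂ i) p) =
      Polynomial.aeval (fockField d i) p := by
  rw [← Polynomial.aeval_algHom_apply, FreeAlgebra.lift_ι_apply]

theorem chainEmb_single_zero {d : ℕ} (i : Fin d) (v : List (Fin d)) :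
    chainEmb i v (Finsupp.single 0 1) = Finsupp.single v 1 := by
  simp [chainEmb, Finsupp.mapDomain_single]

theorem freeSemicircularLaw_aeval {d : ℕ} (i : Fin d) (p : Polynomial ℂ) :
    freeSemicircularLaw d (Polynomial.aeval (FreeAlgebra.ι ℂ i) p) =
      Polynomial.aeval chainField p (Finsupp.single 0 1) 0 := by
  rw [freeSemicircularLaw_apply, lift_aeval_ι, ← chainEmb_single_zero i [],
    aeval_fockField_chainEmb i [] (by simp)]
  have hinj : Function.Injective fun n : ℕ => List.replicate n i ++ ([] : List (Fin d)) := by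
    intro a b h
    simpa using congrArg List.length h
  exact Finsupp.mapDomain_apply hinj _ 0

theorem chainEmb_apply_eq_zero {d : ℕ} (i : Fin d) (v : List (Fin d)) (x : ℕ →₀ ℂ) (hx : x 0 = 0)
    (w : List (Fin d)) (hw : w.head? ≠ some i) : chainEmb i v x w = 0 := by
  simp only [chainEmb, Finsupp.lmapDomain_apply, Finsupp.mapDomain, Finsupp.sum_apply]
  refine Finset.sum_eq_zero fun n _ => ?_
  cases n with
  | zero => simp [hx]
  | succ n =>
    refine (Finsupp.single_apply).trans (if_neg ?_)
    rintro rfl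
    exact hw rfl

theorem aeval_fockField_apply_eq_zero {d : ℕ} (i : Fin d) (p : Polynomial ℂ)
    (hp : Polynomial.aeval chainField p (Finsupp.single 0 1) 0 = 0) (ξ : Fock d)
    (hξ : ∀ v, v.head? = some i → ξ v = 0) (w : List (Fin d)) (hw : w.head? ≠ some i) :
    Polynomial.aeval (fockField d i) p ξ w = 0 := by
  have hsum : ξ = ∑ v ∈ ξ.support, ξ v • chainEmb i v (Finsupp.single 0 1) := by
    conv_lhs => rw [← Finsupp.sum_single ξ]
    refine Finset.sum_congr rfl fun v _ => ?_
    rw [chainEmb_single_zero, Finsupp.smul_single, smul_eq_mul, mul_one]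
  rw [hsum, map_sum, Finsupp.finsetSum_apply]
  refine Finset.sum_eq_zero fun v hv => ?_
  have hv' : v.head? ≠ some i := fun h => (Finsupp.mem_support_iff.1 hv) (hξ v h)
  rw [map_smul, aeval_fockField_chainEmb i v hv', Finsupp.smul_apply,
    chainEmb_apply_eq_zero i v _ hp w hw, smul_zero]

theorem freeSemicircularLaw_free {d : ℕ} (L : List (Fin d × Polynomial ℂ))
    (hL : L.IsChain (fun a b => a.1 ≠ b.1))
    (h0 : ∀ a ∈ L, freeSemicircularLaw d (Polynomial.aeval (FreeAlgebra.ι ℂ a.1) a.2) = 0)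
    (w : List (Fin d)) (hw : ∀ a ∈ L.head?, w.head? ≠ some a.1) (hw' : L = [] → w ≠ []) :
    FreeAlgebra.lift ℂ (fockField d)
      (L.map fun a => Polynomial.aeval (FreeAlgebra.ι ℂ a.1) a.2).prod
      (Finsupp.single [] 1) w = 0 := by
  induction L generalizing w with
  | nil => simpa [Finsupp.single_apply] using hw' rfl
  | cons a L ih =>
    rw [List.map_cons, List.prod_cons, map_mul, Module.End.mul_apply, lift_aeval_ι]
    refine aeval_fockField_apply_eq_zero a.1 a.2 ?_ _ ?_ w (hw a rfl)
    · rw [← freeSemicircularLaw_aeval]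
      exact h0 a List.mem_cons_self
    · intro v hv
      refine ih hL.of_cons (fun b hb => h0 b (List.mem_cons_of_mem _ hb)) v ?_ ?_
      · intro b hb
        rw [hv]
        cases L with
        | nil => simp at hb
        | cons c L =>
          simp only [List.head?_cons, Option.mem_def, Option.some.injEq] at hb
          subst hb
          rw [List.isChain_cons_cons] at hL
          simpa using hL.1
      · rintro - rfl
        simp at hv

theorem chainField_apply_zero (x : ℕ →₀ ℂ) : chainField x 0 = x 1 := by
  have : Finsupp.mapDomain Nat.succ x 0 = 0 := Finsupp.mapDomain_of_notMem_range _ _ (by simp)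
  simp [chainField, Finsupp.lcomapDomain, Finsupp.comapDomain_apply, this]

theorem chainField_apply_succ (x : ℕ →₀ ℂ) (k : ℕ) :
    chainField x (k + 1) = x k + x (k + 2) := by
  have : Finsupp.mapDomain Nat.succ x (k + 1) = x k :=
    Finsupp.mapDomain_apply Nat.succ_injective x k
  simp [chainField, Finsupp.lcomapDomain, Finsupp.comapDomain_apply, this]

/-- Ballot numbers as coefficients of `chainField ^ n` applied to `e_0`. -/
theorem chainField_pow_apply (n : ℕ) :
    (∀ k j, n = k + 2 * j → (chainField ^ n) (Finsupp.single 0 1) k =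
      (n.choose j : ℂ) - if j = 0 then 0 else (n.choose (j - 1) : ℂ)) ∧
    (∀ k, n < k → (chainField ^ n) (Finsupp.single 0 1) k = 0) ∧
    (∀ k, Odd (n + k) → (chainField ^ n) (Finsupp.single 0 1) k = 0) := by
  induction n with
  | zero =>
    refine ⟨fun k j h => ?_, fun k hk => ?_, fun k hk => ?_⟩
    · obtain ⟨rfl, rfl⟩ : k = 0 ∧ j = 0 := by omega
      simp
    · simp [hk.ne]
    · have : (0 : ℕ) ≠ k := by rintro rfl; simp at hk
      simp [this]
  | succ n ih =>
    obtain ⟨h1, h2, h3⟩ := ih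
    refine ⟨fun k j h => ?_, fun k hk => ?_, fun k hk => ?_⟩
    · rw [pow_succ', Module.End.mul_apply]
      cases k with
      | zero =>
        obtain ⟨j, rfl⟩ : ∃ i, j = i + 1 := ⟨j - 1, by omega⟩
        have hn : n = 2 * j + 1 := by omega
        rw [chainField_apply_zero, h1 1 j (by omega)]
        subst hn
        have hsym : (2 * j + 1).choose (j + 1) = (2 * j + 1).choose j := by
          rw [← Nat.choose_symm_of_eq_add]; omega
        rw [Nat.choose_succ_succ' (2 * j + 1) j, hsym]
        cases j with
        | zero => norm_num
        | succ j =>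
          simp only [Nat.add_sub_cancel, Nat.add_eq_zero_iff, one_ne_zero, and_false, if_false]
          rw [Nat.choose_succ_succ' (2 * (j + 1) + 1) j]
          push_cast
          ring
      | succ k =>
        rw [chainField_apply_succ, h1 k j (by omega)]
        cases j with
        | zero =>
          rw [h2 (k + 2) (by omega)]
          simp
        | succ j =>
          rw [h1 (k + 2) j (by omega), Nat.choose_succ_succ' n j]
          cases j with
          | zero => simp
          | succ j =>
            simp only [Nat.add_sub_cancel, Nat.add_eq_zero_iff, one_ne_zero, and_false, if_false]
            rw [Nat.choose_succ_succ' n j]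
            push_cast
            ring
    · rw [pow_succ', Module.End.mul_apply]
      obtain ⟨k, rfl⟩ : ∃ i, k = i + 1 := ⟨k - 1, by omega⟩
      rw [chainField_apply_succ, h2 k (by omega), h2 (k + 2) (by omega), add_zero]
    · rw [pow_succ', Module.End.mul_apply]
      cases k with
      | zero => rw [chainField_apply_zero, h3 1 hk]
      | succ k =>
        rw [chainField_apply_succ, h3 k (by grind), h3 (k + 2) (by grind), add_zero]

theorem freeSemicircularLaw_pow {d : ℕ} (i : Fin d) (n : ℕ) :
    freeSemicircularLaw d (FreeAlgebra.ι ℂ i ^ n) =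
      (chainField ^ n) (Finsupp.single 0 1) 0 := by
  simpa using freeSemicircularLaw_aeval i (Polynomial.X ^ n)

/-- The vacuum law above is indeed the law of `d` free standard semicircular variables. -/
theorem isFreeSemicircularLaw_freeSemicircularLaw (d : ℕ) :
    IsFreeSemicircularLaw (freeSemicircularLaw d) where
  mass := by simp [freeSemicircularLaw_apply]
  even_moment i p := by
    rw [freeSemicircularLaw_pow, (chainField_pow_apply (2 * p)).1 0 p (by omega)]
    cases p with
    | zero => simp
    | succ p =>
      have h := succ_mul_catalan_eq_centralBinom (p + 1)
      have h' := Nat.choose_succ_right_eq (2 * (p + 1)) p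
      rw [Nat.centralBinom] at h
      have e : 2 * (p + 1) - p = p + 2 := by omega
      rw [e] at h'
      simp only [Nat.add_sub_cancel, Nat.add_eq_zero_iff, one_ne_zero, and_false, if_false]
      have hc : (((p : ℂ) + 1 + 1) * catalan (p + 1) = (2 * (p + 1)).choose (p + 1)) := by
        exact_mod_cast h
      have hc' : ((2 * (p + 1)).choose (p + 1) : ℂ) * (p + 1) =
          (2 * (p + 1)).choose p * (p + 2) := by exact_mod_cast h'
      have hp : (p : ℂ) + 2 ≠ 0 := by exact_mod_cast (by omega : p + 2 ≠ 0)
      apply mul_left_cancel₀ hp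
      linear_combination hc' - hc
  odd_moment i p := by
    rw [freeSemicircularLaw_pow, (chainField_pow_apply (2 * p + 1)).2.2 0 (by simp)]
  free L hne hL h0 := by
    rw [freeSemicircularLaw_apply]
    exact freeSemicircularLaw_free L hL h0 [] (by simp) (fun h => absurd h hne)

/-! ### Random Pauli strings and the two developments -/

/-- The Pauli matrices `σ_I, σ_X, σ_Y, σ_Z`. -/
def pauli : Fin 4 → Matrix (Fin 2) (Fin 2) ℂ :=
  ![!![1, 0; 0, 1], !![0, 1; 1, 0], !![0, -Complex.I; Complex.I, 0], !![1, 0; 0, -1]]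

/-- `N × N` complex matrices, `N = 2^n`, with rows and columns indexed by the computational basis
of `(ℂ^2)^{⊗ n}`. -/
abbrev QubitMatrix (n : ℕ) : Type := Matrix (Fin n → Fin 2) (Fin n → Fin 2) ℂ

/-- The Borel (product) `σ`-algebra on the entries. -/
instance instMeasurableSpaceQubitMatrix (n : ℕ) : MeasurableSpace (QubitMatrix n) :=
  inferInstanceAs (MeasurableSpace ((Fin n → Fin 2) → (Fin n → Fin 2) → ℂ))

/-- The Pauli string `σ_{w_1} ⊗ ⋯ ⊗ σ_{w_n}`. -/
def pauliString {n : ℕ} (w : Fin n → Fin 4) : QubitMatrix n :=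
  Matrix.of fun a b => ∏ k, pauli (w k) (a k) (b k)

/-- `m^{-1/2} ∑_i r_i σ_{w_i}` for signs `r_i` and words `w_i`. -/
def pauliSum {n m : ℕ} (x : Fin m → ℤˣ × (Fin n → Fin 4)) : QubitMatrix n :=
  ((1 / √(m : ℝ) : ℝ) : ℂ) • ∑ i, (((x i).1 : ℤ) : ℂ) • pauliString (x i).2

/-- The random Pauli ensemble with `m` strings on `n` qubits: the law of
`m^{-1/2} ∑_i r_i σ(1)^i ⊗ ⋯ ⊗ σ(n)^i` with all `r_i` and `σ(k)^i` independent and uniform, that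
is, with the finite family of signs and letters uniform on its (product) range. -/
def randomPauliEnsemble (n m : ℕ) : Measure (QubitMatrix n) :=
  ((PMF.uniformOfFintype (Fin m → ℤˣ × (Fin n → Fin 4))).map pauliSum).toMeasure

/-- The normalised trace `N⁻¹ Tr`, `N = 2^n`. -/
def normTrace {n : ℕ} (M : QubitMatrix n) : ℂ := (2 ^ n : ℂ)⁻¹ * M.trace

/-- The term `i^{|w|} τ(X_w) S^w_{s,t}(γ)`. -/
def gueTerm {d : ℕ} {T : ℝ} (γ : BVPath d T) (s t : ℝ) (w : List (Fin d)) : ℂ :=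
  Complex.I ^ w.length * freeSemicircularLaw d (w.map (FreeAlgebra.ι ℂ)).prod * (γ.sig w s t : ℂ)

/-- The large-`N` GUE development `⟨γ_{s,t}⟩ = ∑_w i^{|w|} τ(X_w) S^w_{s,t}(γ)`. -/
def gueDevelopment {d : ℕ} {T : ℝ} (γ : BVPath d T) (s t : ℝ) : ℂ := ∑' w, gueTerm γ s t w

end

/-! Picard iteration gives `tr U_{s,t} = ∑_w i^{|w|} S^w tr A_w`, so the quantity to control is `∑_w
i^{|w|} S^w (tr A_w - τ(X_w))`. A word of length `k` has `|S^w| ≤ (3dℓ)^k / k!`, and there are `d^k`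
such words. By Minkowski's inequality in `L²` it is therefore enough that the root mean square of
`tr A_w - τ(X_w)` be at most `2 · 8^k √(k!) (m⁻¹ + 4⁻ⁿ)^{1/2}`: the remaining series has terms of
order `x^k / √(k!)` and converges to a number depending on `d` and `ℓ` only.

The matrices are Hermitian and `τ(X_w)` is real, so this second moment is a combination of `E[tr A_w
tr A_{w reversed}]`, `E[tr A_w]` and `E[tr A_{w reversed}]`. The core is thus the comparison of `E ∏
tr A_w` with `∏ τ(X_w)` (`norm_traceMoment_sub_prod_le`), where both sides are shown to satisfy the
same recursion, the second one exactly and the first one approximately.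

For `τ` the recursion is `τ(X_i X_w) = ∑_{w = u i v} τ(X_u) τ(X_v)`, read off from Fock space
(`semicircularMoment_cons`). For the matrices, expand every `A_i` into its `m` strings, so that each
letter `i` carries a colour `j`, and look at the first coloured letter `q`. Averaging over signs
kills every colouring in which some coloured letter occurs an odd number of times. If `q` occurs
exactly twice, completeness of the Pauli basis applies: when both occurrences lie in one trace, `E
tr(σBσC) = tr B tr C` reproduces the recursion exactly; when they lie in two traces, `E tr(σB)
tr(σC) = 4⁻ⁿ tr(BC)` is an error of order `4⁻ⁿ`. If `q` occurs at least four times, only trivial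
bounds are used, but such colourings are rare.

The counting behind this: deleting a matched pair shows that there are at most `√(K! m^K)` even
colourings of `K` letters, which the normalisation `m^{-K/2}` balances. If the first colour is used
again after the deletion, it ranges over at most `K` values instead of `m`, which gains the factor
`m⁻¹`. The growth `√(K!)` is what the factorial decay of the signature absorbs at the end. -/

noncomputable section

/-! ### Splittings of a word at a letter -/

/-- All pairs `(u, v)` with `l = u ++ a :: v`. -/
def splits {α : Type*} [DecidableEq α] (a : α) : List α → List (List α × List α)
  | [] => []
  | b :: l => (if b = a then [([], l)] else []) ++ (splits a l).map fun p => (b :: p.1, p.2)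

section Splits

variable {α : Type*} [DecidableEq α] {M : Type*} [AddCommMonoid M]

/-- The sum of `f u v` over all splittings `l = u ++ a :: v`. -/
def splitSum (a : α) (l : List α) (f : List α → List α → M) : M :=
  ((splits a l).map fun p => f p.1 p.2).sum

@[simp] theorem splitSum_nil (a : α) (f : List α → List α → M) : splitSum a [] f = 0 := rfl

theorem splitSum_cons (a b : α) (l : List α) (f : List α → List α → M) :
    splitSum a (b :: l) f =
      (if b = a then f [] l else 0) + splitSum a l fun u v => f (b :: u) v := by
  simp only [splitSum, splits, List.map_append, List.sum_append, List.map_map, Function.comp_def]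
  split_ifs <;> simp

theorem mem_splits {a : α} {l : List α} {p : List α × List α} :
    p ∈ splits a l ↔ l = p.1 ++ a :: p.2 := by
  induction l generalizing p with
  | nil => simp [splits]
  | cons b l ih =>
    simp only [splits, List.mem_append, List.mem_map]
    constructor
    · rintro (h | ⟨q, hq, rfl⟩)
      · split_ifs at h with hb
        · simp only [List.mem_singleton] at h; subst h; simp [hb]
        · simp at h
      · simp [ih.1 hq]
    · intro h
      rcases p with ⟨_ | ⟨c, u⟩, v⟩
      · left; simp at h; simp [h.1, h.2]
      · right
        simp at h
        exact ⟨(u, v), ih.2 h.2, by simp [h.1]⟩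

theorem length_splits (a : α) (l : List α) : (splits a l).length = l.count a := by
  induction l with
  | nil => rfl
  | cons b l ih =>
    simp only [splits, List.length_append, List.length_map, ih, List.count_cons]
    split_ifs <;> simp_all [add_comm]

theorem splitSum_congr {a : α} {l : List α} {f g : List α → List α → M}
    (h : ∀ u v, l = u ++ a :: v → f u v = g u v) : splitSum a l f = splitSum a l g :=
  congrArg List.sum (List.map_congr_left fun p hp => h p.1 p.2 (mem_splits.1 hp))

theorem splitSum_add (a : α) (l : List α) (f g : List α → List α → M) :
    splitSum a l (fun u v => f u v + g u v) = splitSum a l f + splitSum a l g :=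
  List.sum_map_add

theorem splitSum_eq_zero {a : α} {l : List α} {f : List α → List α → M}
    (h : ∀ u v, l = u ++ a :: v → f u v = 0) : splitSum a l f = 0 := by
  rw [splitSum_congr h]; simp [splitSum]

theorem splitSum_of_notMem {a : α} {l : List α} (h : a ∉ l) (f : List α → List α → M) :
    splitSum a l f = 0 :=
  splitSum_eq_zero fun u v e => absurd (by simp [e]) h

theorem splitSum_of_eq {a : α} {u v : List α} (hu : a ∉ u) (hv : a ∉ v)
    (f : List α → List α → M) : splitSum a (u ++ a :: v) f = f u v := by
  induction u generalizing f with
  | nil => simp [splitSum_cons, splitSum_of_notMem hv]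
  | cons b u ih =>
    simp only [List.mem_cons, not_or] at hu
    rw [List.cons_append, splitSum_cons, if_neg (Ne.symm hu.1), ih hu.2, zero_add]

/-- Both sides enumerate the factorisations of `l` as `x a y b z`, located by the left marker first
or by the right marker first. -/
theorem splitSum_splitSum (a b : α) (l : List α) (f : List α → List α → List α → M) :
    (splitSum a l fun u v => splitSum b v fun p q => f u p q) =
      splitSum b l fun u v => splitSum a u fun p q => f p q v := by
  induction l generalizing f with
  | nil => rfl
  | cons c l ih =>
    have h : (splitSum b l fun u v => splitSum a (c :: u) fun p q => f p q v) =
        (splitSum b l fun u v => if c = a then f [] u v else 0) +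
          splitSum b l fun u v => splitSum a u fun p q => f (c :: p) q v := by
      rw [← splitSum_add]
      exact splitSum_congr fun u v _ => splitSum_cons ..
    rw [splitSum_cons, splitSum_cons, h, ih fun u p q => f (c :: u) p q, splitSum_nil]
    split_ifs <;> simp [splitSum]

theorem splitSum_le_splitSum {a : α} {l : List α} {f g : List α → List α → ℝ}
    (h : ∀ u v, l = u ++ a :: v → f u v ≤ g u v) : splitSum a l f ≤ splitSum a l g :=
  List.sum_le_sum fun p hp => h p.1 p.2 (mem_splits.1 hp)

theorem splitSum_le {a : α} {l : List α} {f : List α → List α → ℝ} {c : ℝ}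
    (h : ∀ u v, l = u ++ a :: v → f u v ≤ c) : splitSum a l f ≤ l.count a * c := by
  refine (splitSum_le_splitSum h).trans_eq ?_
  simp [splitSum, length_splits]

theorem norm_splitSum_le {E : Type*} [SeminormedAddCommGroup E] (a : α) (l : List α)
    (f : List α → List α → E) : ‖splitSum a l f‖ ≤ splitSum a l fun u v => ‖f u v‖ := by
  rw [splitSum, splitSum]
  induction splits a l with
  | nil => simp
  | cons p s ih =>
    simp only [List.map_cons, List.sum_cons]
    exact (norm_add_le _ _).trans (by gcongr)

theorem splitSum_sub {E : Type*} [AddCommGroup E] (a : α) (l : List α)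
    (f g : List α → List α → E) :
    splitSum a l f - splitSum a l g = splitSum a l fun u v => f u v - g u v := by
  rw [sub_eq_iff_eq_add, ← splitSum_add]
  simp

theorem splitSum_nonneg {a : α} {l : List α} {f : List α → List α → ℝ}
    (h : ∀ u v, 0 ≤ f u v) : 0 ≤ splitSum a l f :=
  List.sum_nonneg fun x hx => by
    obtain ⟨p, -, rfl⟩ := List.mem_map.1 hx
    exact h _ _

end Splits

/-! ### Moments of free semicircular variables -/

section Fock

variable {d : ℕ}

/-- The operator `X_{w_1} ⋯ X_{w_k}` on Fock space. -/
def fockWord (w : List (Fin d)) : Module.End ℂ (Fock d) := (w.map (fockField d)).prod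

/-- The moment `τ(X_w)`. -/
def semicircularMoment (w : List (Fin d)) : ℂ :=
  freeSemicircularLaw d (w.map (FreeAlgebra.ι ℂ)).prod

theorem semicircularMoment_eq (w : List (Fin d)) :
    semicircularMoment w = fockWord w (Finsupp.single [] 1) [] := by
  rw [semicircularMoment, freeSemicircularLaw_apply, map_list_prod, List.map_map, fockWord]
  congr!
  simp

@[simp] theorem semicircularMoment_nil : semicircularMoment ([] : List (Fin d)) = 1 := by
  simp [semicircularMoment_eq, fockWord]

theorem fockField_apply_nil (i : Fin d) (ξ : Fock d) : fockField d i ξ [] = ξ [i] := by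
  have : Finsupp.mapDomain (List.cons i) ξ [] = 0 :=
    Finsupp.mapDomain_of_notMem_range _ _ (by simp)
  simp [fockField, Finsupp.lcomapDomain, Finsupp.comapDomain_apply, this]

theorem fockField_apply_cons (i j : Fin d) (v : List (Fin d)) (ξ : Fock d) :
    fockField d i ξ (j :: v) = (if j = i then ξ v else 0) + ξ (i :: j :: v) := by
  have h : Finsupp.mapDomain (List.cons i) ξ (j :: v) = if j = i then ξ v else 0 := by
    split_ifs with h
    · subst h; exact Finsupp.mapDomain_apply List.cons_injective _ _
    · exact Finsupp.mapDomain_of_notMem_range _ _ (by simpa using Ne.symm h)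
  simp [fockField, Finsupp.lcomapDomain, Finsupp.comapDomain_apply, h]

theorem fockField_single_nil (i : Fin d) :
    fockField d i (Finsupp.single [] 1) = Finsupp.single [i] 1 := by
  ext v
  cases v with
  | nil => simp [fockField_apply_nil]
  | cons j v =>
    rw [fockField_apply_cons]
    by_cases h : j = i <;> cases v <;> simp [h]

theorem fockField_single_cons (i j : Fin d) (u : List (Fin d)) :
    fockField d i (Finsupp.single (j :: u) 1) =
      (if j = i then Finsupp.single u 1 else 0) + Finsupp.single (i :: j :: u) 1 := by
  ext v
  cases v with
  | nil =>
    rw [fockField_apply_nil]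
    by_cases h : j = i <;> simp [Finsupp.single_apply, h]
  | cons k v =>
    rw [fockField_apply_cons]
    by_cases h : j = i <;> by_cases h' : k = i <;>
      (simp [Finsupp.single_apply, h, h', eq_comm (a := i)]; try grind)

theorem fockWord_cons (i : Fin d) (w : List (Fin d)) :
    fockWord (i :: w) = fockField d i * fockWord w := by simp [fockWord]

/-- Each field `ℓ_i + ℓ_i^*` is symmetric for the basis of words, so transposing a product reverses
it. -/
theorem fockWord_symm (w u v : List (Fin d)) :
    fockWord w (Finsupp.single v 1) u = fockWord w.reverse (Finsupp.single u 1) v := by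
  induction w generalizing u with
  | nil => simp [fockWord, Finsupp.single_apply, eq_comm]
  | cons i w ih =>
    have h : fockWord (i :: w).reverse = fockWord w.reverse * fockField d i := by
      simp [fockWord]
    rw [h, fockWord_cons, Module.End.mul_apply, Module.End.mul_apply]
    cases u with
    | nil => rw [fockField_apply_nil, fockField_single_nil, ih]
    | cons j u =>
      rw [fockField_apply_cons, fockField_single_cons, map_add, Finsupp.add_apply, ih, ih]
      split_ifs <;> simp

theorem conj_fockWord (w v u : List (Fin d)) :
    (starRingEnd ℂ) (fockWord w (Finsupp.single v 1) u) = fockWord w (Finsupp.single v 1) u := by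
  induction w generalizing u with
  | nil => simp only [fockWord, List.map_nil, List.prod_nil, Module.End.one_apply,
      Finsupp.single_apply]; split_ifs <;> simp
  | cons i w ih =>
    rw [fockWord_cons, Module.End.mul_apply]
    cases u with
    | nil => rw [fockField_apply_nil, ih]
    | cons j u => rw [fockField_apply_cons]; split_ifs <;> simp [ih]

theorem semicircularMoment_reverse (w : List (Fin d)) :
    semicircularMoment w.reverse = semicircularMoment w := by
  rw [semicircularMoment_eq, semicircularMoment_eq, fockWord_symm w]

theorem conj_semicircularMoment (w : List (Fin d)) :
    (starRingEnd ℂ) (semicircularMoment w) = semicircularMoment w := by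
  rw [semicircularMoment_eq, conj_fockWord]

/-- A coefficient of `fockField d i ξ` is a sum of at most two coefficients of `ξ`, so each letter
at most doubles the supremum of the coefficients. -/
theorem norm_fockWord_le (w u : List (Fin d)) :
    ‖fockWord w (Finsupp.single [] 1) u‖ ≤ 2 ^ w.length := by
  induction w generalizing u with
  | nil => simp only [fockWord, List.map_nil, List.prod_nil, Module.End.one_apply,
      Finsupp.single_apply]; split_ifs <;> simp
  | cons i w ih =>
    rw [fockWord_cons, Module.End.mul_apply, List.length_cons, pow_succ]
    have hp : (0 : ℝ) ≤ 2 ^ w.length := by positivity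
    cases u with
    | nil => rw [fockField_apply_nil]; linarith [ih [i]]
    | cons j u =>
      rw [fockField_apply_cons]
      have h : ‖(if j = i then fockWord w (Finsupp.single [] 1) u else 0)‖ ≤ 2 ^ w.length := by
        split_ifs
        · exact ih u
        · simp
      exact (norm_add_le _ _).trans (by linarith [ih (i :: j :: u)])

theorem norm_semicircularMoment_le (w : List (Fin d)) :
    ‖semicircularMoment w‖ ≤ 2 ^ w.length := by
  rw [semicircularMoment_eq]; exact norm_fockWord_le w []

/-- The letter `i` at the head of the final word was created by one definite letter of `w`. What
acts before it (the suffix `v`) must have built `z`; what acts after it (the prefix `u`) must build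
and remove everything on top of `i`, which contributes a vacuum moment. -/
theorem fockWord_apply_cons (w : List (Fin d)) (i : Fin d) (z : List (Fin d)) :
    fockWord w (Finsupp.single [] 1) (i :: z) =
      splitSum i w fun u v => semicircularMoment u * fockWord v (Finsupp.single [] 1) z := by
  induction hn : w.length using Nat.strong_induction_on generalizing w i z with
  | _ n ih =>
    cases w with
    | nil => simp [fockWord]
    | cons a w =>
      simp only [List.length_cons] at hn
      -- Two letters `a`, `i` on top of `z` are peeled off one after the other; this is why the
      -- induction is over all `z` and over length.
      have h1 : fockWord w (Finsupp.single [] 1) (a :: i :: z) =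
          splitSum a w fun u v => splitSum i v fun p q =>
            semicircularMoment u * (semicircularMoment p *
              fockWord q (Finsupp.single [] 1) z) := by
        rw [ih w.length (by omega) w a (i :: z) rfl]
        refine splitSum_congr fun u v e => ?_
        rw [ih v.length (by simp [e] at hn; omega) v i z rfl, splitSum, splitSum,
          List.sum_map_mul_left]
      -- The moment of `a :: u` is the coefficient of the one-letter word `[a]`, so it expands by
      -- the same induction. The result is the sum in `h1` in the other order of markers.
      have h2 : (splitSum i w fun u v => semicircularMoment (a :: u) *
          fockWord v (Finsupp.single [] 1) z) = splitSum i w fun u v => splitSum a u fun p q =>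
            semicircularMoment p * (semicircularMoment q *
              fockWord v (Finsupp.single [] 1) z) := by
        refine splitSum_congr fun u v e => ?_
        rw [semicircularMoment_eq (a :: u), fockWord_cons, Module.End.mul_apply,
          fockField_apply_nil, ih u.length (by simp [e] at hn; omega) u a [] rfl, splitSum,
          splitSum, ← List.sum_map_mul_right]
        simp only [← semicircularMoment_eq, mul_assoc]
      rw [fockWord_cons, Module.End.mul_apply, fockField_apply_cons, splitSum_cons, h1, h2,
        splitSum_splitSum, semicircularMoment_nil, one_mul]
      simp only [eq_comm (a := i)]

/-- The Schwinger-Dyson (free Gaussian integration by parts) recursion. -/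
theorem semicircularMoment_cons (i : Fin d) (w : List (Fin d)) :
    semicircularMoment (i :: w) =
      splitSum i w fun u v => semicircularMoment u * semicircularMoment v := by
  rw [semicircularMoment_eq (i :: w), fockWord_cons, Module.End.mul_apply, fockField_apply_nil,
    fockWord_apply_cons]
  simp only [← semicircularMoment_eq]

end Fock

end

noncomputable section

open scoped BigOperators

/-! ### Pauli strings -/

section Pauli

variable {n : ℕ}

/-- Completeness of the Pauli basis: `∑ σ ⊗ σ` is twice the swap operator. -/
theorem sum_pauli_mul_pauli (a b c e : Fin 2) :
    ∑ p, pauli p a b * pauli p c e = if a = e ∧ b = c then 2 else 0 := by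
  fin_cases a <;> fin_cases b <;> fin_cases c <;> fin_cases e <;>
    simp [Fin.sum_univ_four, pauli] <;> norm_num

theorem star_pauli (p : Fin 4) (a b : Fin 2) : star (pauli p b a) = pauli p a b := by
  fin_cases p <;> fin_cases a <;> fin_cases b <;> simp [pauli]

theorem sum_pauli_mul_self (p : Fin 4) (a c : Fin 2) :
    ∑ b, pauli p a b * pauli p b c = if a = c then 1 else 0 := by
  fin_cases p <;> fin_cases a <;> fin_cases c <;> simp [pauli]

theorem pauliString_isHermitian (w : Fin n → Fin 4) : (pauliString w).IsHermitian := by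
  ext a b
  simp [pauliString, Matrix.conjTranspose_apply, ← star_pauli (w _) (a _) (b _)]

theorem pauliString_mul_self (w : Fin n → Fin 4) : pauliString w * pauliString w = 1 := by
  ext a b
  simp only [pauliString, Matrix.mul_apply, Matrix.of_apply, ← Finset.prod_mul_distrib]
  rw [← Fintype.prod_sum fun k x => pauli (w k) (a k) x * pauli (w k) x (b k)]
  simp only [sum_pauli_mul_self, Matrix.one_apply, Finset.prod_ite_zero, funext_iff]
  simp

theorem pauliString_mem_unitary (w : Fin n → Fin 4) :
    pauliString w ∈ Matrix.unitaryGroup (Fin n → Fin 2) ℂ := by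
  rw [Matrix.mem_unitaryGroup_iff, Matrix.star_eq_conjTranspose, pauliString_isHermitian,
    pauliString_mul_self]

theorem sum_pauliString_mul_pauliString (a b c e : Fin n → Fin 2) :
    ∑ w : Fin n → Fin 4, pauliString w a b * pauliString w c e =
      if a = e ∧ b = c then 2 ^ n else 0 := by
  simp only [pauliString, Matrix.of_apply, ← Finset.prod_mul_distrib]
  rw [← Fintype.prod_sum fun k x => pauli x (a k) (b k) * pauli x (c k) (e k)]
  simp only [sum_pauli_mul_pauli, Finset.prod_ite_zero, funext_iff, Finset.mem_univ, true_imp_iff,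
    forall_and]
  simp

theorem expect_eq_sum {ι : Type*} [Fintype ι] (f : ι → ℂ) :
    Finset.expect Finset.univ f = (Fintype.card ι : ℂ)⁻¹ * ∑ i, f i := by
  rw [Fintype.expect_eq_sum_div_card, div_eq_inv_mul]

/-- Conjugation by a uniform Pauli string replaces `B` by `tr B` times the identity. This holds
exactly at every `n`. -/
theorem expect_normTrace_mul_mul (B C : QubitMatrix n) :
    Finset.expect Finset.univ (fun w => normTrace (pauliString w * B * pauliString w * C)) =
      normTrace B * normTrace C := by
  have h : ∑ w : Fin n → Fin 4, (pauliString w * B * pauliString w * C).trace =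
      2 ^ n * (B.trace * C.trace) := by
    have h1 : ∀ w : Fin n → Fin 4, (pauliString w * B * pauliString w * C).trace =
        ∑ a, ∑ e, ∑ c, ∑ b, pauliString w a b * pauliString w c e * (B b c * C e a) := by
      intro w
      simp only [Matrix.trace, Matrix.diag_apply, Matrix.mul_apply, Finset.sum_mul]
      refine Finset.sum_congr rfl fun a _ => Finset.sum_congr rfl fun e _ =>
        Finset.sum_congr rfl fun c _ => Finset.sum_congr rfl fun b _ => by ring
    simp only [h1]
    rw [Finset.sum_comm]
    have h2 : ∀ a : Fin n → Fin 2, ∑ w : Fin n → Fin 4, ∑ e, ∑ c, ∑ b,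
        pauliString w a b * pauliString w c e * (B b c * C e a) =
        ∑ b, 2 ^ n * (B b b * C a a) := by
      intro a
      rw [Finset.sum_comm]
      simp only [Finset.sum_comm (s := (Finset.univ : Finset (Fin n → Fin 4))), ← Finset.sum_mul,
        sum_pauliString_mul_pauliString]
      rw [Finset.sum_eq_single a (fun e _ he => by simp [Ne.symm he]) (by simp)]
      simp
    simp only [h2, Matrix.trace, Matrix.diag_apply, ← Finset.mul_sum, Finset.sum_mul_sum]
    rw [Finset.sum_comm]
    simp only [Finset.mul_sum]
  rw [expect_eq_sum]
  simp only [normTrace, ← Finset.mul_sum, h]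
  simp only [Fintype.card_pi, Fintype.card_fin, Finset.prod_const, Finset.card_univ]
  have : ((4 ^ n : ℕ) : ℂ) = 2 ^ n * 2 ^ n := by rw [← mul_pow]; norm_num
  rw [this]
  field_simp

/-- The Pauli strings are an orthonormal basis for the normalised trace, so the sum over strings is
Parseval's identity; the average divides it by their number `4^n`. -/
theorem expect_normTrace_mul_normTrace (B C : QubitMatrix n) :
    Finset.expect Finset.univ
      (fun w => normTrace (pauliString w * B) * normTrace (pauliString w * C)) =
      (4 ^ n : ℂ)⁻¹ * normTrace (B * C) := by
  have h : ∑ w : Fin n → Fin 4, (pauliString w * B).trace * (pauliString w * C).trace =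
      2 ^ n * (B * C).trace := by
    have h1 : ∀ w : Fin n → Fin 4, (pauliString w * B).trace * (pauliString w * C).trace =
        ∑ a, ∑ c, ∑ b, ∑ e, pauliString w a b * pauliString w c e * (B b a * C e c) := by
      intro w
      simp only [Matrix.trace, Matrix.diag_apply, Matrix.mul_apply, Finset.sum_mul_sum]
      refine Finset.sum_congr rfl fun a _ => Finset.sum_congr rfl fun e _ =>
        Finset.sum_congr rfl fun c _ => Finset.sum_congr rfl fun b _ => by ring
    simp only [h1]
    simp only [Finset.sum_comm (s := (Finset.univ : Finset (Fin n → Fin 4))), ← Finset.sum_mul,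
        sum_pauliString_mul_pauliString]
    have h2 : ∀ a c : Fin n → Fin 2, ∑ b, ∑ e, (if a = e ∧ b = c then (2 : ℂ) ^ n else 0) *
        (B b a * C e c) = 2 ^ n * (B c a * C a c) := by
      intro a c
      rw [Finset.sum_eq_single c (fun e _ he => by simp [he]) (by simp)]
      simp
    simp only [h2, ← Finset.mul_sum, Matrix.trace, Matrix.diag_apply, Matrix.mul_apply]
    rw [Finset.sum_comm]
  rw [expect_eq_sum]
  have h3 : ∀ w : Fin n → Fin 4, normTrace (pauliString w * B) * normTrace (pauliString w * C) =
      (2 ^ n : ℂ)⁻¹ * (2 ^ n : ℂ)⁻¹ * ((pauliString w * B).trace * (pauliString w * C).trace) :=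
    fun w => by simp only [normTrace]; ring
  rw [Finset.sum_congr rfl fun w _ => h3 w, ← Finset.mul_sum, h, normTrace]
  simp only [Fintype.card_pi, Fintype.card_fin, Finset.prod_const, Finset.card_univ]
  push_cast
  field_simp

theorem normTrace_mul_comm (B C : QubitMatrix n) : normTrace (B * C) = normTrace (C * B) := by
  rw [normTrace, Matrix.trace_mul_comm, normTrace]

theorem norm_normTrace_le_one {B : QubitMatrix n}
    (hB : B ∈ Matrix.unitaryGroup (Fin n → Fin 2) ℂ) : ‖normTrace B‖ ≤ 1 := by
  rw [normTrace, norm_mul, norm_inv, norm_pow, Complex.norm_ofNat, inv_mul_le_iff₀ (by positivity)]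
  refine (norm_sum_le _ _).trans ((Finset.sum_le_sum fun a _ =>
    entry_norm_bound_of_unitary hB a a).trans ?_)
  simp

@[simp] theorem normTrace_one : normTrace (1 : QubitMatrix n) = 1 := by
  simp [normTrace]

@[simp] theorem normTrace_smul (c : ℂ) (B : QubitMatrix n) :
    normTrace (c • B) = c * normTrace B := by
  simp [normTrace, mul_left_comm]

end Pauli

end

noncomputable section

open scoped BigOperators

/-! ### Moments of independent signed Pauli strings -/

section PauliMoment

variable {Q : Type*} {n : ℕ}

/-- A sign together with `n` Pauli letters. -/
abbrev SignedWord (n : ℕ) : Type := ℤˣ × (Fin n → Fin 4)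

/-- The matrix `r σ_{w_1} ⊗ ⋯ ⊗ σ_{w_n}`. -/
def signedPauli (y : SignedWord n) : QubitMatrix n := ((y.1 : ℤ) : ℂ) • pauliString y.2

/-- The product of the signed Pauli strings `x q` along a word of indices. -/
def pauliWord (x : Q → SignedWord n) (l : List Q) : QubitMatrix n :=
  (l.map fun q => signedPauli (x q)).prod

/-- The product of the normalised traces of several words. -/
def traceProd (x : Q → SignedWord n) (R : List (List Q)) : ℂ :=
  (R.map fun l => normTrace (pauliWord x l)).prod

@[simp] theorem pauliWord_nil (x : Q → SignedWord n) : pauliWord x [] = 1 := rfl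

theorem pauliWord_cons (x : Q → SignedWord n) (q : Q) (l : List Q) :
    pauliWord x (q :: l) = signedPauli (x q) * pauliWord x l := by simp [pauliWord]

theorem pauliWord_append (x : Q → SignedWord n) (u v : List Q) :
    pauliWord x (u ++ v) = pauliWord x u * pauliWord x v := by simp [pauliWord]

@[simp] theorem traceProd_nil (x : Q → SignedWord n) : traceProd x [] = 1 := rfl

theorem traceProd_cons (x : Q → SignedWord n) (l : List Q) (R : List (List Q)) :
    traceProd x (l :: R) = normTrace (pauliWord x l) * traceProd x R := by simp [traceProd]

theorem traceProd_append (x : Q → SignedWord n) (R S : List (List Q)) :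
    traceProd x (R ++ S) = traceProd x R * traceProd x S := by simp [traceProd]

theorem intUnit_mem_unitary (r : ℤˣ) : ((r : ℤ) : ℂ) ∈ unitary ℂ := by
  rcases Int.units_eq_one_or r with rfl | rfl <;> simp [Unitary.mem_iff]

theorem signedPauli_mem_unitary (y : SignedWord n) :
    signedPauli y ∈ Matrix.unitaryGroup (Fin n → Fin 2) ℂ :=
  Unitary.smul_mem_of_mem (intUnit_mem_unitary y.1) (pauliString_mem_unitary y.2)

theorem signedPauli_isHermitian (y : SignedWord n) : (signedPauli y).IsHermitian := by
  rw [signedPauli, Matrix.IsHermitian, Matrix.conjTranspose_smul, pauliString_isHermitian]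
  simp

theorem pauliWord_mem_unitary (x : Q → SignedWord n) (l : List Q) :
    pauliWord x l ∈ Matrix.unitaryGroup (Fin n → Fin 2) ℂ := by
  refine Submonoid.list_prod_mem _ fun B hB => ?_
  obtain ⟨q, -, rfl⟩ := List.mem_map.1 hB
  exact signedPauli_mem_unitary _

theorem norm_traceProd_le_one (x : Q → SignedWord n) (R : List (List Q)) :
    ‖traceProd x R‖ ≤ 1 := by
  induction R with
  | nil => simp
  | cons l R ih =>
    rw [traceProd_cons, norm_mul]
    exact mul_le_one₀ (norm_normTrace_le_one (pauliWord_mem_unitary x l)) (norm_nonneg _) ih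

variable [DecidableEq Q]

theorem pauliWord_update_of_notMem (x : Q → SignedWord n) {q : Q} (y : SignedWord n) {l : List Q}
    (h : q ∉ l) : pauliWord (Function.update x q y) l = pauliWord x l := by
  refine congrArg List.prod (List.map_congr_left fun p hp => ?_)
  rw [Function.update_of_ne (ne_of_mem_of_not_mem hp h)]

theorem traceProd_update_of_notMem (x : Q → SignedWord n) {q : Q} (y : SignedWord n)
    {R : List (List Q)} (h : q ∉ R.flatten) :
    traceProd (Function.update x q y) R = traceProd x R := by
  refine congrArg List.prod (List.map_congr_left fun l hl => ?_)
  rw [pauliWord_update_of_notMem x y fun hq => h (List.mem_flatten.2 ⟨l, hl, hq⟩)]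

theorem pauliWord_update_sign (x : Q → SignedWord n) (q : Q) (r : ℤˣ) (w : Fin n → Fin 4)
    (l : List Q) : pauliWord (Function.update x q (r, w)) l =
      ((r : ℤ) : ℂ) ^ l.count q • pauliWord (Function.update x q (1, w)) l := by
  induction l with
  | nil => simp
  | cons p l ih =>
    rw [pauliWord_cons, pauliWord_cons, ih, List.count_cons]
    by_cases h : p = q
    · subst h
      simp [signedPauli, pow_succ, smul_smul, mul_comm]
    · simp [h]

theorem traceProd_update_sign (x : Q → SignedWord n) (q : Q) (r : ℤˣ) (w : Fin n → Fin 4)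
    (R : List (List Q)) : traceProd (Function.update x q (r, w)) R =
      ((r : ℤ) : ℂ) ^ R.flatten.count q * traceProd (Function.update x q (1, w)) R := by
  induction R with
  | nil => simp
  | cons l R ih =>
    rw [traceProd_cons, traceProd_cons, ih, pauliWord_update_sign, normTrace_smul,
      List.flatten_cons, List.count_append, pow_add]
    ring

variable [Fintype Q]

/-- Resampling one coordinate preserves the uniform law. It allows averaging over the string `q`
alone with all the others frozen. -/
theorem expect_update {Y : Type*} [Fintype Y] (F : (Q → Y) → ℂ) (q : Q) :
    Finset.expect Finset.univ F = Finset.expect Finset.univ fun x : Q → Y =>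
      Finset.expect Finset.univ fun y => F (Function.update x q y) := by
  rcases isEmpty_or_nonempty Y with hY | hY
  · have : IsEmpty (Q → Y) := ⟨fun x => hY.elim (x q)⟩
    simp
  -- Exchanging the coordinate `q` with the fresh sample is an involution.
  let e : (Q → Y) × Y ≃ (Q → Y) × Y :=
    { toFun := fun z => (Function.update z.1 q z.2, z.1 q)
      invFun := fun z => (Function.update z.1 q z.2, z.1 q)
      left_inv := fun z => by simp
      right_inv := fun z => by simp }
  have h : (Finset.univ : Finset ((Q → Y) × Y)).expect (fun z => F (Function.update z.1 q z.2)) =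
      Finset.univ.expect fun z : (Q → Y) × Y => F z.1 :=
    Fintype.expect_equiv e _ _ fun z => rfl
  rw [← Finset.univ_product_univ, Finset.expect_product, Finset.expect_product] at h
  rw [h]
  simp

/-- The expectation of a product of normalised traces of words in independent uniform signed Pauli
strings. -/
def pauliMoment (n : ℕ) (R : List (List Q)) : ℂ :=
  Finset.expect Finset.univ fun x : Q → SignedWord n => traceProd x R

theorem norm_expect_le {ι : Type*} [Fintype ι] [Nonempty ι] {f : ι → ℂ} {c : ℝ}
    (h : ∀ i, ‖f i‖ ≤ c) : ‖Finset.expect Finset.univ f‖ ≤ c := by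
  rw [expect_eq_sum, norm_mul, norm_inv, Complex.norm_natCast, inv_mul_le_iff₀ (by positivity)]
  refine (norm_sum_le _ _).trans ((Finset.sum_le_sum fun i _ => h i).trans ?_)
  simp

theorem norm_pauliMoment_le_one (R : List (List Q)) : ‖pauliMoment n R‖ ≤ 1 :=
  norm_expect_le fun x => norm_traceProd_le_one x R

theorem expect_intUnit_pow (k : ℕ) :
    Finset.expect Finset.univ (fun r : ℤˣ => ((r : ℤ) : ℂ) ^ k) = if Even k then 1 else 0 := by
  have : (Finset.univ : Finset ℤˣ) = {1, -1} := rfl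
  rw [expect_eq_sum, this, Finset.sum_pair (by decide)]
  split_ifs with h
  · simp [h.neg_pow, Fintype.card_units_int]; norm_num
  · simp [(Nat.not_even_iff_odd.1 h).neg_pow]

/-- The sign of `q` factors out as `r ^ count`, whose mean is `1` or `0` according to parity; only
the average over Pauli letters is left. -/
theorem pauliMoment_eq_expect (R : List (List Q)) (q : Q) :
    pauliMoment n R = if Even (R.flatten.count q) then
      Finset.expect Finset.univ fun x : Q → SignedWord n =>
        Finset.expect Finset.univ fun w : Fin n → Fin 4 =>
          traceProd (Function.update x q (1, w)) R else 0 := by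
  rw [pauliMoment, expect_update _ q]
  have h : ∀ x : Q → SignedWord n, (Finset.expect Finset.univ fun y =>
      traceProd (Function.update x q y) R) = (if Even (R.flatten.count q) then 1 else 0) *
        Finset.expect Finset.univ fun w : Fin n → Fin 4 =>
          traceProd (Function.update x q (1, w)) R := by
    intro x
    rw [← Finset.univ_product_univ, Finset.expect_product, ← expect_intUnit_pow,
      Finset.expect_mul_expect]
    exact Finset.expect_congr rfl fun r _ => Finset.expect_congr rfl fun w _ =>
      traceProd_update_sign x q r w R
  simp only [h, ← Finset.mul_expect]
  split_ifs <;> simp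

theorem pauliMoment_eq_zero (R : List (List Q)) (q : Q) (h : ¬ Even (R.flatten.count q)) :
    pauliMoment n R = 0 := by
  rw [pauliMoment_eq_expect R q, if_neg h]

theorem signedPauli_one (w : Fin n → Fin 4) : signedPauli (1, w) = pauliString w := by
  simp [signedPauli]

/-- The main term: with no other occurrence of `q`, averaging over it splits the trace by `E
tr(σBσC) = tr B tr C`. -/
theorem pauliMoment_pair (q : Q) (u v : List Q) (R : List (List Q)) (hu : q ∉ u) (hv : q ∉ v)
    (hR : q ∉ R.flatten) :
    pauliMoment n ((q :: (u ++ q :: v)) :: R) = pauliMoment n (u :: v :: R) := by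
  rw [pauliMoment_eq_expect _ q, if_pos, pauliMoment]
  · refine Finset.expect_congr rfl fun x _ => ?_
    have h : ∀ w : Fin n → Fin 4, traceProd (Function.update x q (1, w))
        ((q :: (u ++ q :: v)) :: R) =
        normTrace (pauliString w * pauliWord x u * pauliString w * pauliWord x v) *
          traceProd x R := by
      intro w
      rw [traceProd_cons, traceProd_update_of_notMem _ _ hR, pauliWord_cons, pauliWord_append,
        pauliWord_cons, pauliWord_update_of_notMem _ _ hu, pauliWord_update_of_notMem _ _ hv,
        Function.update_self, signedPauli_one]
      simp only [mul_assoc]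
    simp only [h, ← Finset.expect_mul, expect_normTrace_mul_mul]
    rw [traceProd_cons, traceProd_cons, mul_assoc]
  · simp [List.count_eq_zero.2 hu, List.count_eq_zero.2 hv,
      List.count_eq_zero.2 hR]

/-- A pair shared by two traces merges them, at the cost of a factor `4⁻ⁿ`; the merged traces are of
unitaries, hence at most `1` in modulus. -/
theorem norm_pauliMoment_cross_le (q : Q) (l u v : List Q) (R S : List (List Q)) (hl : q ∉ l)
    (hu : q ∉ u) (hv : q ∉ v) (hR : q ∉ R.flatten) (hS : q ∉ S.flatten) :
    ‖pauliMoment n ((q :: l) :: (R ++ (u ++ q :: v) :: S))‖ ≤ (4 ^ n : ℝ)⁻¹ := by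
  rw [pauliMoment_eq_expect _ q, if_pos]
  · refine norm_expect_le fun x => ?_
    have h : ∀ w : Fin n → Fin 4, traceProd (Function.update x q (1, w))
        ((q :: l) :: (R ++ (u ++ q :: v) :: S)) =
        normTrace (pauliString w * pauliWord x l) *
          normTrace (pauliString w * (pauliWord x v * pauliWord x u)) *
          (traceProd x R * traceProd x S) := by
      intro w
      rw [traceProd_cons, traceProd_append, traceProd_cons, traceProd_update_of_notMem _ _ hR,
        traceProd_update_of_notMem _ _ hS, pauliWord_cons, pauliWord_append, pauliWord_cons,
        pauliWord_update_of_notMem _ _ hu, pauliWord_update_of_notMem _ _ hv,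
        pauliWord_update_of_notMem _ _ hl, Function.update_self, signedPauli_one,
        normTrace_mul_comm (pauliWord x u), mul_assoc (pauliString w)]
      ring
    simp only [h, ← Finset.expect_mul, expect_normTrace_mul_normTrace]
    rw [norm_mul, norm_mul, norm_mul, norm_inv, norm_pow, Complex.norm_ofNat, mul_assoc]
    refine mul_le_of_le_one_right (by positivity) (mul_le_one₀ ?_ (by positivity)
      (mul_le_one₀ (norm_traceProd_le_one x R) (norm_nonneg _) (norm_traceProd_le_one x S)))
    rw [← pauliWord_append, ← pauliWord_append]
    exact norm_normTrace_le_one (pauliWord_mem_unitary _ _)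
  · simp [List.count_eq_zero.2 hl, List.count_eq_zero.2 hu,
      List.count_eq_zero.2 hv, List.count_eq_zero.2 hR, List.count_eq_zero.2 hS]

/-- Every letter occurs an even number of times. -/
def EvenWord (l : List Q) : Prop := ∀ q, Even (l.count q)

open Classical in
/-- Schwinger-Dyson equation for signed Pauli strings, with error term. -/
theorem norm_pauliMoment_sub_splitSum_le (q : Q) (l : List Q) (R : List (List Q)) :
    ‖pauliMoment n ((q :: l) :: R) - splitSum q l fun u v => pauliMoment n (u :: v :: R)‖ ≤
      (if EvenWord (q :: (l ++ R.flatten)) then 1 else 0) * ((4 ^ n : ℝ)⁻¹ +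
        (if 3 ≤ (l ++ R.flatten).count q then 1 else 0) * (1 + l.count q)) := by
  have hflat : ((q :: l) :: R).flatten = q :: (l ++ R.flatten) := by simp
  by_cases he : EvenWord (q :: (l ++ R.flatten))
  swap
  -- A splitting removes exactly two copies of `q`, so all parities are unchanged and every moment
  -- involved vanishes.
  · rw [if_neg he, zero_mul]
    obtain ⟨p, hp⟩ := not_forall.1 he
    rw [pauliMoment_eq_zero _ p (by rwa [hflat]), splitSum_eq_zero]
    · simp
    · intro u v e
      refine pauliMoment_eq_zero _ p fun h => hp ?_
      subst e
      simp only [List.flatten_cons, List.count_append, List.count_cons] at h ⊢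
      split_ifs <;> grind
  rw [if_pos he, one_mul]
  -- With at least four occurrences nothing cancels: the moment counts for `1` and each splitting
  -- for `1`. Such colourings are later shown to be few.
  by_cases h3 : 3 ≤ (l ++ R.flatten).count q
  · rw [if_pos h3, one_mul]
    have h1 : ‖splitSum q l fun u v => pauliMoment n (u :: v :: R)‖ ≤ l.count q * 1 :=
      (norm_splitSum_le _ _ _).trans (splitSum_le fun u v _ => norm_pauliMoment_le_one _)
    have h2 := norm_pauliMoment_le_one (n := n) ((q :: l) :: R)
    have h4 : (0 : ℝ) ≤ (4 ^ n : ℝ)⁻¹ := by positivity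
    refine (norm_sub_le _ _).trans ?_
    linarith
  rw [if_neg h3, zero_mul, add_zero]
  -- Evenness including the leading `q` makes this count odd, and it is below `3`.
  have h1 : (l ++ R.flatten).count q = 1 := by
    have := he q
    rw [List.count_cons_self] at this
    grind
  rw [List.count_append] at h1
  by_cases hl : q ∈ l
  · obtain ⟨u, v, rfl⟩ := List.append_of_mem hl
    simp only [List.count_append, List.count_cons_self] at h1
    have hu : q ∉ u := List.count_eq_zero.1 (by omega)
    have hv : q ∉ v := List.count_eq_zero.1 (by omega)
    rw [splitSum_of_eq hu hv, pauliMoment_pair q u v R hu hv (List.count_eq_zero.1 (by omega))]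
    simp
  · rw [splitSum_of_notMem hl, sub_zero]
    rw [List.count_eq_zero.2 hl] at h1
    obtain ⟨p, hp, hqp⟩ := List.mem_flatten.1 (List.count_pos_iff.1 (by omega : 0 < R.flatten.count q))
    obtain ⟨R, S, rfl⟩ := List.append_of_mem hp
    obtain ⟨u, v, rfl⟩ := List.append_of_mem hqp
    simp only [List.flatten_append, List.flatten_cons, List.count_append,
      List.count_cons_self] at h1
    exact norm_pauliMoment_cross_le q l u v R S hl (List.count_eq_zero.1 (by omega))
      (List.count_eq_zero.1 (by omega)) (List.count_eq_zero.1 (by omega))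
      (List.count_eq_zero.1 (by omega))

end PauliMoment

end

noncomputable section

open scoped BigOperators Nat

/-! ### Sums over colourings of words -/

section ColorSum

variable {ι M N : Type*} {m : ℕ} [AddCommMonoid M] [AddCommMonoid N]

/-- The sum of `f` over all ways of attaching an index in `Fin m` to each letter of a word. -/
def colorSum (m : ℕ) : List ι → (List (ι × Fin m) → M) → M
  | [], f => f []
  | i :: w, f => ∑ j, colorSum m w fun l => f ((i, j) :: l)

/-- The sum of `F` over all ways of attaching an index in `Fin m` to each letter of each word. -/
def colorSums (m : ℕ) : List (List ι) → (List (List (ι × Fin m)) → M) → M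
  | [], F => F []
  | w :: L, F => colorSum m w fun l => colorSums m L fun R => F (l :: R)

theorem colorSum_map (T : M →+ N) (w : List ι) (f : List (ι × Fin m) → M) :
    T (colorSum m w f) = colorSum m w fun l => T (f l) := by
  induction w generalizing f with
  | nil => rfl
  | cons i w ih => simp only [colorSum, map_sum, ih]

theorem colorSums_map (T : M →+ N) (L : List (List ι)) (F : List (List (ι × Fin m)) → M) :
    T (colorSums m L F) = colorSums m L fun R => T (F R) := by
  induction L generalizing F with
  | nil => rfl
  | cons w L ih => simp only [colorSums, colorSum_map, ih]

theorem colorSum_add (w : List ι) (f g : List (ι × Fin m) → M) :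
    (colorSum m w fun l => f l + g l) = colorSum m w f + colorSum m w g := by
  induction w generalizing f g with
  | nil => rfl
  | cons i w ih => simp only [colorSum, ih, Finset.sum_add_distrib]

theorem colorSums_add (L : List (List ι)) (F G : List (List (ι × Fin m)) → M) :
    (colorSums m L fun R => F R + G R) = colorSums m L F + colorSums m L G := by
  induction L generalizing F G with
  | nil => rfl
  | cons w L ih => simp only [colorSums, ih, colorSum_add]

theorem colorSum_sum {κ : Type*} (s : Finset κ) (w : List ι) (f : κ → List (ι × Fin m) → M) :
    (colorSum m w fun l => ∑ k ∈ s, f k l) = ∑ k ∈ s, colorSum m w (f k) := by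
  induction w generalizing f with
  | nil => rfl
  | cons i w ih => simp only [colorSum, ih]; exact Finset.sum_comm

theorem colorSum_append (u v : List ι) (f : List (ι × Fin m) → M) :
    colorSum m (u ++ v) f = colorSum m u fun a => colorSum m v fun b => f (a ++ b) := by
  induction u generalizing f with
  | nil => rfl
  | cons i u ih => simp only [List.cons_append, colorSum, ih]

theorem colorSums_flatten (L : List (List ι)) (f : List (ι × Fin m) → M) :
    (colorSums m L fun R => f R.flatten) = colorSum m L.flatten f := by
  induction L generalizing f with
  | nil => rfl
  | cons w L ih =>
    simp only [colorSums, List.flatten_cons, colorSum_append]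
    congr 1; ext l
    exact ih fun b => f (l ++ b)

theorem colorSum_mono {w : List ι} {f g : List (ι × Fin m) → ℝ}
    (h : ∀ l, l.length = w.length → f l ≤ g l) : colorSum m w f ≤ colorSum m w g := by
  induction w generalizing f g with
  | nil => exact h [] rfl
  | cons i w ih => exact Finset.sum_le_sum fun j _ => ih fun l hl => h _ (by simp [hl])

theorem norm_colorSum_le {E : Type*} [SeminormedAddCommGroup E] (w : List ι)
    (f : List (ι × Fin m) → E) : ‖colorSum m w f‖ ≤ colorSum m w fun l => ‖f l‖ := by
  induction w generalizing f with
  | nil => exact le_rfl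
  | cons i w ih => exact (norm_sum_le _ _).trans (Finset.sum_le_sum fun j _ => ih _)

theorem norm_colorSums_le {E : Type*} [SeminormedAddCommGroup E] (L : List (List ι))
    (F : List (List (ι × Fin m)) → E) : ‖colorSums m L F‖ ≤ colorSums m L fun R => ‖F R‖ := by
  induction L generalizing F with
  | nil => exact le_rfl
  | cons w L ih => exact (norm_colorSum_le w _).trans (colorSum_mono fun l _ => ih _)

theorem colorSums_mono {L : List (List ι)} {F G : List (List (ι × Fin m)) → ℝ}
    (h : ∀ R, F R ≤ G R) : colorSums m L F ≤ colorSums m L G := by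
  induction L generalizing F G with
  | nil => exact h []
  | cons w L ih => exact colorSum_mono fun l _ => ih fun R => h _

theorem colorSum_zero (w : List ι) : (colorSum m w fun _ => (0 : M)) = 0 := by
  induction w with
  | nil => rfl
  | cons i w ih => simp [colorSum, ih]

theorem splitSum_sum {κ α : Type*} [DecidableEq α] (s : Finset κ) (a : α) (l : List α)
    (f : κ → List α → List α → M) :
    (splitSum a l fun u v => ∑ k ∈ s, f k u v) = ∑ k ∈ s, splitSum a l (f k) := by
  simp only [splitSum]
  induction splits a l with
  | nil => simp
  | cons p t ih => simp [ih, Finset.sum_add_distrib]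

theorem splitSum_map {α : Type*} [DecidableEq α] (T : M →+ N) (a : α) (l : List α)
    (f : List α → List α → M) :
    T (splitSum a l f) = splitSum a l fun u v => T (f u v) := by
  simp [splitSum, map_list_sum, Function.comp_def]

theorem le_splitSum {α : Type*} [DecidableEq α] {a : α} {l u v : List α}
    {f : List α → List α → ℝ} (hf : ∀ u v, 0 ≤ f u v) (h : l = u ++ a :: v) :
    f u v ≤ splitSum a l f := by
  refine List.single_le_sum (fun x hx => ?_) _
    (List.mem_map.2 ⟨(u, v), mem_splits.2 h, rfl⟩)
  obtain ⟨p, -, rfl⟩ := List.mem_map.1 hx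
  exact hf _ _

variable [DecidableEq ι]

/-- Choosing a coloured position equal to `(i, j)` amounts to choosing an uncoloured position equal
to `i`, fixing its colour to `j`, and colouring the two remaining pieces freely. -/
theorem colorSum_splitSum (i : ι) (j : Fin m) (w : List ι)
    (f : List (ι × Fin m) → List (ι × Fin m) → M) :
    (colorSum m w fun l => splitSum (i, j) l f) =
      splitSum i w fun a b => colorSum m a fun u => colorSum m b fun v => f u v := by
  induction w generalizing f with
  | nil => rfl
  | cons k w ih =>
    simp only [colorSum, splitSum_cons, colorSum_add, Finset.sum_add_distrib, ih, splitSum_sum]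
    congr 1
    by_cases h : k = i
    · subst h
      simp only [Prod.mk.injEq, true_and, if_true]
      rw [Finset.sum_eq_single j (fun j' _ hj => by simp [hj, colorSum_zero]) (by simp)]
      simp
    · simp [h, colorSum_zero]

end ColorSum

/-! ### Counting even colourings -/

section Count

variable {ι : Type*} [DecidableEq ι] {m : ℕ}

theorem EvenWord.exists_split {Q : Type*} [DecidableEq Q] {q : Q} {l : List Q}
    (h : EvenWord (q :: l)) : ∃ u v, l = u ++ q :: v ∧ EvenWord (u ++ v) := by
  have hq : q ∈ l := by
    by_contra hq
    have := h q
    simp [List.count_eq_zero.2 hq] at this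
  obtain ⟨u, v, rfl⟩ := List.append_of_mem hq
  refine ⟨u, v, rfl, fun p => ?_⟩
  have := h p
  simp only [List.count_append, List.count_cons] at this ⊢
  split_ifs at this <;> grind

/-- This is the source of the gain `m⁻¹`: a colour that must already be present in a given coloured
word has at most its length many values, not `m`. -/
theorem card_filter_mem_le (i : ι) (l : List (ι × Fin m)) :
    (Finset.univ.filter fun j : Fin m => (i, j) ∈ l).card ≤ l.length :=
  (Finset.card_le_card_of_injOn (t := l.toFinset) (fun j => (i, j)) (fun j hj => by simpa using hj)
    (fun a _ b _ h => by simpa using h)).trans (List.toFinset_card_le l)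

theorem succ_mul_sqrt_factorial_le (k : ℕ) : ((k : ℝ) + 1) * √(k ! : ℝ) ≤ √((k + 2)! : ℝ) := by
  apply Real.le_sqrt_of_sq_le
  rw [mul_pow, Real.sq_sqrt (by positivity), Nat.factorial_succ, Nat.factorial_succ]
  push_cast
  nlinarith [(by positivity : (0 : ℝ) ≤ (k + 1) * k !)]

open Classical in
/-- The number of even colourings of a word of length `k` is at most `√(k! m^k)`. -/
theorem colorSum_evenWord_le (w : List ι) :
    (colorSum m w fun l => if EvenWord l then (1 : ℝ) else 0) ≤ √(w.length ! : ℝ) * √m ^ w.length := by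
  induction hn : w.length using Nat.strong_induction_on generalizing w with
  | _ n ih =>
    cases w with
    | nil => subst hn; simp [colorSum, EvenWord]
    | cons i w =>
      have h1 : ∀ j, (colorSum m w fun l => if EvenWord ((i, j) :: l) then (1 : ℝ) else 0) ≤
          w.count i * (√((n - 2)! : ℝ) * √m ^ (n - 2)) := by
        intro j
        -- An even colouring has a second copy of its first coloured letter, and deleting both
        -- leaves an even colouring. Summing over all possible partners only overcounts.
        have h : (colorSum m w fun l => if EvenWord ((i, j) :: l) then (1 : ℝ) else 0) ≤
            colorSum m w fun l => splitSum (i, j) l fun u v =>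
              if EvenWord (u ++ v) then (1 : ℝ) else 0 := by
          refine colorSum_mono fun l _ => ?_
          have h0 : ∀ u v : List (ι × Fin m), (0 : ℝ) ≤ if EvenWord (u ++ v) then (1 : ℝ) else 0 :=
            fun u v => by split_ifs <;> simp
          split_ifs with he
          · obtain ⟨u, v, e, huv⟩ := he.exists_split
            refine le_trans ?_ (le_splitSum h0 e)
            rw [if_pos huv]
          · exact splitSum_nonneg h0
        refine h.trans ?_
        rw [colorSum_splitSum]
        refine splitSum_le fun u v e => ?_
        rw [← colorSum_append u v fun l => if EvenWord l then (1 : ℝ) else 0]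
        refine (ih (u ++ v).length ?_ (u ++ v) rfl).trans_eq ?_
        · rw [← hn, e]; simp
        · rw [← hn, e]; simp [← add_assoc]
      refine (Finset.sum_le_sum fun j _ => h1 j).trans ?_
      rw [Finset.sum_const, Finset.card_univ, Fintype.card_fin, nsmul_eq_mul]
      -- The truncated `n - 2` is harmless: for a single letter there is no partner and the count is
      -- zero.
      rcases Nat.lt_or_ge n 2 with hn2 | hn2
      · have : w = [] := List.length_eq_zero_iff.1 (by simp at hn; omega)
        subst this
        simp only [List.count_nil, Nat.cast_zero, zero_mul, mul_zero]
        positivity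
      · obtain ⟨k, rfl⟩ : ∃ k, n = k + 2 := ⟨n - 2, by omega⟩
        have hc : (w.count i : ℝ) ≤ k + 1 := by
          have : w.count i ≤ k + 1 := List.count_le_length.trans (by simp at hn; omega)
          exact_mod_cast this
        have hm : √(m : ℝ) ^ (k + 2) = m * √m ^ k := by
          rw [pow_add, Real.sq_sqrt (by positivity), mul_comm]
        rw [Nat.add_sub_cancel, hm]
        calc (m : ℝ) * (w.count i * (√(k ! : ℝ) * √m ^ k))
            ≤ m * ((k + 1) * (√(k ! : ℝ) * √m ^ k)) := by gcongr
          _ = ((k + 1) * √(k ! : ℝ)) * (m * √m ^ k) := by ring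
          _ ≤ _ := by gcongr; exact succ_mul_sqrt_factorial_le k

open Classical in
/-- Even colourings in which the colour of the first letter occurs at least four times. -/
theorem sum_colorSum_evenWord_three_le (i : ι) (w : List ι) :
    (∑ j, colorSum m w fun l => (if EvenWord ((i, j) :: l) then (1 : ℝ) else 0) *
      if 3 ≤ l.count (i, j) then 1 else 0) ≤
      w.length * ((w.length - 1 : ℕ) * (√((w.length - 1)! : ℝ) * √m ^ (w.length - 1))) := by
  -- After one partner is deleted, at least two copies of `(i, j)` remain; membership in the
  -- remainder is all that is kept.
  have h : ∀ j : Fin m, (colorSum m w fun l => (if EvenWord ((i, j) :: l) then (1 : ℝ) else 0) *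
      if 3 ≤ l.count (i, j) then 1 else 0) ≤ splitSum i w fun a b => colorSum m (a ++ b) fun l =>
        (if EvenWord l then (1 : ℝ) else 0) * if (i, j) ∈ l then 1 else 0 := by
    intro j
    have e : (splitSum i w fun a b => colorSum m (a ++ b) fun l =>
        (if EvenWord l then (1 : ℝ) else 0) * if (i, j) ∈ l then 1 else 0) =
        colorSum m w fun l => splitSum (i, j) l fun u v =>
          (if EvenWord (u ++ v) then (1 : ℝ) else 0) * if (i, j) ∈ u ++ v then 1 else 0 := by
      rw [colorSum_splitSum]
      exact splitSum_congr fun u v _ => colorSum_append ..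
    rw [e]
    refine colorSum_mono fun l _ => ?_
    have h0 : ∀ u v : List (ι × Fin m), (0 : ℝ) ≤
        (if EvenWord (u ++ v) then (1 : ℝ) else 0) * if (i, j) ∈ u ++ v then 1 else 0 :=
      fun u v => by split_ifs <;> simp
    by_cases he : EvenWord ((i, j) :: l)
    · by_cases h3 : 3 ≤ l.count (i, j)
      · obtain ⟨u, v, e, huv⟩ := he.exists_split
        refine le_trans ?_ (le_splitSum h0 e)
        rw [e, List.count_append, List.count_cons_self] at h3
        have : (i, j) ∈ u ++ v := List.count_pos_iff.1 (by rw [List.count_append]; omega)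
        rw [if_pos huv, if_pos this]
        split_ifs <;> simp
      · rw [if_neg h3, mul_zero]; exact splitSum_nonneg h0
    · rw [if_neg he, zero_mul]; exact splitSum_nonneg h0
  refine (Finset.sum_le_sum fun j _ => h j).trans ?_
  rw [← splitSum_sum]
  refine (splitSum_le (c := (w.length - 1 : ℕ) * (√((w.length - 1)! : ℝ) * √m ^ (w.length - 1)))
    fun u v e => ?_).trans ?_
  · have hl : (u ++ v).length = w.length - 1 := by rw [e]; simp [← add_assoc]
    -- The sum over `j` goes innermost: for a fixed remainder only the colours present in it
    -- contribute.
    rw [← colorSum_sum]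
    have h1 : (colorSum m (u ++ v) fun l => ∑ j, (if EvenWord l then (1 : ℝ) else 0) *
        if (i, j) ∈ l then 1 else 0) ≤ colorSum m (u ++ v) fun l =>
          (w.length - 1 : ℕ) * if EvenWord l then (1 : ℝ) else 0 := by
      refine colorSum_mono fun l hl' => ?_
      rw [← Finset.mul_sum, mul_comm]
      refine mul_le_mul_of_nonneg_right ?_ (by split_ifs <;> simp)
      rw [Finset.sum_boole]
      exact_mod_cast (card_filter_mem_le i l).trans (by rw [hl', hl])
    refine h1.trans ?_
    have h2 := colorSum_map (m := m) (AddMonoidHom.mulLeft ((w.length - 1 : ℕ) : ℝ)) (u ++ v)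
      fun l => if EvenWord l then (1 : ℝ) else 0
    simp only [AddMonoidHom.coe_mulLeft] at h2
    rw [← h2]
    refine mul_le_mul_of_nonneg_left ?_ (by positivity)
    rw [← hl]
    exact colorSum_evenWord_le (u ++ v)
  · gcongr
    exact List.count_le_length

end Count

end

noncomputable section

open scoped BigOperators Nat

/-! ### Moments of random Pauli sums -/

section TraceMoment

variable {d n m : ℕ}

/-- The product `A_{w_1} ⋯ A_{w_k}`. -/
def matWord (A : Fin d → QubitMatrix n) (w : List (Fin d)) : QubitMatrix n := (w.map A).prod

@[simp] theorem matWord_nil (A : Fin d → QubitMatrix n) : matWord A [] = 1 := rfl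

theorem matWord_cons (A : Fin d → QubitMatrix n) (i : Fin d) (w : List (Fin d)) :
    matWord A (i :: w) = A i * matWord A w := by simp [matWord]

/-- The random Pauli sums built from all signed words. -/
def pauliSums (x : Fin d × Fin m → SignedWord n) (i : Fin d) : QubitMatrix n :=
  pauliSum fun j => x (i, j)

theorem pauliSums_eq (x : Fin d × Fin m → SignedWord n) (i : Fin d) :
    pauliSums x i = ((1 / √(m : ℝ) : ℝ) : ℂ) • ∑ j, signedPauli (x (i, j)) := rfl

theorem matWord_pauliSums (x : Fin d × Fin m → SignedWord n) (w : List (Fin d)) :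
    matWord (pauliSums x) w =
      ((1 / √(m : ℝ) : ℝ) : ℂ) ^ w.length • colorSum m w fun l => pauliWord x l := by
  induction w with
  | nil => simp [colorSum]
  | cons i w ih =>
    have h : ∀ j, (colorSum m w fun l => pauliWord x ((i, j) :: l)) =
        signedPauli (x (i, j)) * colorSum m w fun l => pauliWord x l := fun j => by
      have := colorSum_map (m := m) (AddMonoidHom.mulLeft (signedPauli (x (i, j)))) w
        fun l => pauliWord x l
      simp only [AddMonoidHom.coe_mulLeft] at this
      rw [this]
      simp only [pauliWord_cons]
    rw [matWord_cons, ih, pauliSums_eq, colorSum]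
    simp only [h]
    rw [← Finset.sum_mul, smul_mul_smul_comm, List.length_cons, pow_succ']

/-- The normalised trace as an additive map. -/
def normTraceHom (n : ℕ) : QubitMatrix n →+ ℂ where
  toFun := normTrace
  map_zero' := by simp [normTrace]
  map_add' := fun A B => by simp [normTrace, mul_add]

theorem normTrace_matWord_pauliSums (x : Fin d × Fin m → SignedWord n) (w : List (Fin d)) :
    normTrace (matWord (pauliSums x) w) =
      ((1 / √(m : ℝ) : ℝ) : ℂ) ^ w.length * colorSum m w fun l => normTrace (pauliWord x l) := by
  rw [matWord_pauliSums, normTrace_smul]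
  exact congrArg _ (colorSum_map (normTraceHom n) w _)

theorem prod_normTrace_matWord (x : Fin d × Fin m → SignedWord n) (L : List (List (Fin d))) :
    (L.map fun w => normTrace (matWord (pauliSums x) w)).prod =
      ((1 / √(m : ℝ) : ℝ) : ℂ) ^ L.flatten.length * colorSums m L (traceProd x) := by
  induction L with
  | nil => simp [colorSums]
  | cons w L ih =>
    have h : colorSums m (w :: L) (traceProd x) =
        (colorSum m w fun l => normTrace (pauliWord x l)) * colorSums m L (traceProd x) := by
      have h1 := colorSum_map (m := m) (AddMonoidHom.mulRight (colorSums m L (traceProd x))) w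
        fun l => normTrace (pauliWord x l)
      simp only [AddMonoidHom.coe_mulRight] at h1
      rw [h1, colorSums]
      congr 1; ext l
      have h2 := colorSums_map (m := m) (AddMonoidHom.mulLeft (normTrace (pauliWord x l))) L
        (traceProd x)
      simp only [AddMonoidHom.coe_mulLeft] at h2
      rw [h2]
      simp only [traceProd_cons]
    rw [List.map_cons, List.prod_cons, ih, normTrace_matWord_pauliSums, h, List.flatten_cons,
      List.length_append, pow_add]
    ring

theorem expect_colorSum {X ι : Type*} [Fintype X] (w : List ι) (f : X → List (ι × Fin m) → ℂ) :
    (Finset.expect Finset.univ fun x => colorSum m w (f x)) =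
      colorSum m w fun l => Finset.expect Finset.univ fun x => f x l := by
  induction w generalizing f with
  | nil => rfl
  | cons i w ih => simp only [colorSum, Finset.expect_sum_comm, ih]

theorem expect_colorSums {X ι : Type*} [Fintype X] (L : List (List ι))
    (F : X → List (List (ι × Fin m)) → ℂ) :
    (Finset.expect Finset.univ fun x => colorSums m L (F x)) =
      colorSums m L fun R => Finset.expect Finset.univ fun x => F x R := by
  induction L generalizing F with
  | nil => rfl
  | cons w L ih => simp only [colorSums, expect_colorSum, ih]

/-- The mixed moment `E ∏_{w ∈ L} tr A_w` of random Pauli sums. -/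
def traceMoment (n m : ℕ) (L : List (List (Fin d))) : ℂ :=
  Finset.expect Finset.univ fun x : Fin d × Fin m → SignedWord n =>
    (L.map fun w => normTrace (matWord (pauliSums x) w)).prod

theorem traceMoment_eq (L : List (List (Fin d))) :
    traceMoment n m L =
      ((1 / √(m : ℝ) : ℝ) : ℂ) ^ L.flatten.length * colorSums m L (pauliMoment n) := by
  simp only [traceMoment, prod_normTrace_matWord, ← Finset.mul_expect, expect_colorSums]
  rfl

@[simp] theorem traceMoment_nil : traceMoment (d := d) n m [] = 1 := by
  simp [traceMoment_eq, colorSums, pauliMoment]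

theorem traceMoment_nil_cons (L : List (List (Fin d))) :
    traceMoment n m ([] :: L) = traceMoment n m L := by
  simp [traceMoment]

/-- A splitting has two letters fewer, so its normalisation lacks a factor `m⁻¹`. The sum over the
common colour `j` of the removed pair supplies the compensating `m` equal terms. -/
theorem splitSum_traceMoment (hm : 0 < m) (i : Fin d) (w : List (Fin d))
    (R : List (List (Fin d))) :
    (splitSum i w fun u v => traceMoment n m (u :: v :: R)) =
      ((1 / √(m : ℝ) : ℝ) : ℂ) ^ ((i :: w) :: R).flatten.length *
        ∑ j, colorSum m w fun l => colorSums m R fun S =>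
          splitSum (i, j) l fun u v => pauliMoment n (u :: v :: S) := by
  have h : ∀ j, (colorSum m w fun l => colorSums m R fun S =>
      splitSum (i, j) l fun u v => pauliMoment n (u :: v :: S)) =
      splitSum i w fun a b => colorSums m (a :: b :: R) (pauliMoment n) := by
    intro j
    have h1 : ∀ l : List (Fin d × Fin m), (colorSums m R fun S =>
        splitSum (i, j) l fun u v => pauliMoment n (u :: v :: S)) =
        splitSum (i, j) l fun u v => colorSums m R fun S => pauliMoment n (u :: v :: S) := by
      intro l
      simp only [splitSum]
      induction splits (i, j) l with
      | nil =>
        have := colorSums_map (m := m) (0 : ℂ →+ ℂ) R fun _ => 0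
        simpa using this.symm
      | cons p t ih => simp only [List.map_cons, List.sum_cons, colorSums_add, ih]
    simp only [h1, colorSum_splitSum]
    rfl
  simp only [h, Finset.sum_const, Finset.card_univ, Fintype.card_fin, nsmul_eq_mul, ← mul_assoc]
  have h2 := splitSum_map (AddMonoidHom.mulLeft
    (((1 / √(m : ℝ) : ℝ) : ℂ) ^ ((i :: w) :: R).flatten.length * m)) i w
    fun a b => colorSums m (a :: b :: R) (pauliMoment n)
  simp only [AddMonoidHom.coe_mulLeft] at h2
  rw [h2]
  refine splitSum_congr fun u v e => ?_
  rw [traceMoment_eq]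
  congr 1
  have h3 : ((i :: w) :: R).flatten.length = (u :: v :: R).flatten.length + 2 := by
    subst e; simp; omega
  have h4 : ((1 / √(m : ℝ) : ℝ) : ℂ) ^ 2 * m = 1 := by
    have hm' : (m : ℝ) ≠ 0 := by positivity
    have : (1 / √(m : ℝ)) ^ 2 * m = 1 := by
      rw [div_pow, Real.sq_sqrt (by positivity)]; field_simp
    exact_mod_cast this
  rw [h3, pow_add, mul_assoc, h4, mul_one]

-- The colourwise Schwinger-Dyson error is summed over all colourings. The `4⁻ⁿ` part meets every
-- even colouring, the other part only those in which the first coloured letter occurs at least four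
-- times; the second count is smaller by a factor `m`.
open Classical in
theorem norm_traceMoment_sub_splitSum_le (hm : 0 < m) (i : Fin d) (w : List (Fin d))
    (R : List (List (Fin d))) {K : ℕ} (hK : ((i :: w) :: R).flatten.length = K) :
    ‖traceMoment n m ((i :: w) :: R) - splitSum i w fun u v => traceMoment n m (u :: v :: R)‖ ≤
      (1 + K) ^ 2 * √(K ! : ℝ) * ((m : ℝ)⁻¹ + (4 ^ n : ℝ)⁻¹) := by
  have hm0 : (0 : ℝ) < m := by exact_mod_cast hm
  have hs : 0 < √(m : ℝ) := Real.sqrt_pos.2 hm0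
  rw [splitSum_traceMoment hm, traceMoment_eq, ← mul_sub, norm_mul, norm_pow, Complex.norm_real,
    Real.norm_of_nonneg (by positivity), hK]
  set W := w ++ R.flatten with hW
  have hWK : W.length + 1 = K := by rw [← hK, hW]; simp
  set e : List (Fin d × Fin m) → ℝ := fun l => if EvenWord l then 1 else 0 with he
  have hsub : colorSums m ((i :: w) :: R) (pauliMoment n) -
      ∑ j, (colorSum m w fun l => colorSums m R fun S =>
          splitSum (i, j) l fun u v => pauliMoment n (u :: v :: S)) =
      ∑ j, colorSum m w fun l => colorSums m R fun S => (pauliMoment n (((i, j) :: l) :: S) -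
          splitSum (i, j) l fun u v => pauliMoment n (u :: v :: S)) := by
    rw [sub_eq_iff_eq_add, ← Finset.sum_add_distrib, colorSums, colorSum]
    refine Finset.sum_congr rfl fun j _ => ?_
    rw [← colorSum_add]
    congr 1; ext l
    rw [← colorSums_add]
    congr 1; ext S
    rw [sub_add_cancel]
  have hbound : ‖∑ j, colorSum m w fun l => colorSums m R fun S =>
      (pauliMoment n (((i, j) :: l) :: S) -
          splitSum (i, j) l fun u v => pauliMoment n (u :: v :: S))‖ ≤
      ∑ j, colorSum m W fun l => ((4 ^ n : ℝ)⁻¹ * e ((i, j) :: l) +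
        K * (e ((i, j) :: l) * if 3 ≤ l.count (i, j) then 1 else 0)) := by
    refine (norm_sum_le _ _).trans (Finset.sum_le_sum fun j _ => ?_)
    refine (norm_colorSum_le _ _).trans ?_
    rw [hW, colorSum_append]
    refine colorSum_mono fun l hl => ?_
    rw [← colorSums_flatten]
    refine (norm_colorSums_le _ _).trans (colorSums_mono fun S => ?_)
    refine (norm_pauliMoment_sub_splitSum_le (n := n) (i, j) l S).trans ?_
    have hc : (1 : ℝ) + l.count (i, j) ≤ K := by
      have h1 : l.count (i, j) ≤ l.length := List.count_le_length
      have h2 : 1 + l.count (i, j) ≤ K := by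
        rw [hl] at h1; rw [← hWK, hW, List.length_append]; omega
      exact_mod_cast h2
    have he0 : 0 ≤ e ((i, j) :: (l ++ S.flatten)) := by simp only [he]; split_ifs <;> simp
    change e _ * _ ≤ _
    rw [mul_add, mul_comm (e _)]
    gcongr _ + ?_
    rw [mul_comm (K : ℝ), ← mul_assoc]
    have : (0 : ℝ) ≤ if 3 ≤ (l ++ S.flatten).count (i, j) then 1 else 0 := by
      split_ifs <;> simp
    -- Two equality tests on coloured letters are in play; both are lawful, so the counts agree.
    have hcnt : ∀ l : List (Fin d × Fin m),
        @List.count _ instBEqOfDecidableEq (i, j) l = @List.count _ instBEqProd (i, j) l := by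
      intro l
      rw [lawful_beq_subsingleton (instBEqProd : BEq (Fin d × Fin m)) instBEqOfDecidableEq]
    gcongr
    · exact le_of_eq (by simp only [hcnt])
    · rw [hcnt]; exact hc
  have hsplit : (∑ j, colorSum m W fun l => ((4 ^ n : ℝ)⁻¹ * e ((i, j) :: l) +
        K * (e ((i, j) :: l) * if 3 ≤ l.count (i, j) then 1 else 0))) =
      (4 ^ n : ℝ)⁻¹ * colorSum m (i :: W) e + K * ∑ j, colorSum m W fun l =>
        (e ((i, j) :: l) * if 3 ≤ l.count (i, j) then 1 else 0) := by
    simp only [colorSum_add, Finset.sum_add_distrib, colorSum, Finset.mul_sum]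
    congr 1
    · refine Finset.sum_congr rfl fun j _ => ?_
      exact (colorSum_map (m := m) (AddMonoidHom.mulLeft ((4 ^ n : ℝ)⁻¹)) W _).symm
    · refine Finset.sum_congr rfl fun j _ => ?_
      exact (colorSum_map (m := m) (AddMonoidHom.mulLeft (K : ℝ)) W _).symm
  have h1 : colorSum m (i :: W) e ≤ √(K ! : ℝ) * √m ^ K := by
    have := colorSum_evenWord_le (m := m) (i :: W)
    rwa [List.length_cons, hWK] at this
  have h2 : (∑ j, colorSum m W fun l => (e ((i, j) :: l) * if 3 ≤ l.count (i, j) then 1 else 0)) ≤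
      K * √(K ! : ℝ) * (√m ^ K / m) := by
    refine (sum_colorSum_evenWord_three_le (m := m) i W).trans ?_
    -- A word with a single letter has no repeated colour, so the truncated `W.length - 1` plays no
    -- role.
    rcases Nat.eq_zero_or_pos W.length with h0 | h0
    · rw [h0]
      simp only [Nat.cast_zero, zero_mul]
      positivity
    · obtain ⟨k, hk⟩ : ∃ k, W.length = k + 1 := ⟨W.length - 1, by omega⟩
      obtain rfl : K = k + 2 := by omega
      rw [hk, Nat.add_sub_cancel]
      have hmk : √(m : ℝ) ^ (k + 2) / m = √m ^ k := by
        rw [pow_add, Real.sq_sqrt hm0.le]; field_simp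
      rw [hmk]
      calc ((k + 1 : ℕ) : ℝ) * (k * (√(k ! : ℝ) * √m ^ k))
          = k * (((k : ℝ) + 1) * √(k ! : ℝ)) * √m ^ k := by push_cast; ring
        _ ≤ ((k + 2 : ℕ) : ℝ) * √((k + 2)! : ℝ) * √m ^ k := by
          gcongr
          · omega
          · exact succ_mul_sqrt_factorial_le k
  rw [hsub]
  -- Here the normalisation absorbs all the growth in `m` of the number of even colourings.
  have hpow : (1 / √(m : ℝ)) ^ K * √m ^ K = 1 := by
    rw [← mul_pow, one_div, inv_mul_cancel₀ hs.ne', one_pow]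
  have hpos : (0 : ℝ) ≤ (1 / √(m : ℝ)) ^ K := by positivity
  calc (1 / √(m : ℝ)) ^ K * _
      ≤ (1 / √(m : ℝ)) ^ K * ((4 ^ n : ℝ)⁻¹ * (√(K ! : ℝ) * √m ^ K) +
          K * (K * √(K ! : ℝ) * (√m ^ K / m))) := by
        refine mul_le_mul_of_nonneg_left ((hbound.trans_eq hsplit).trans ?_) hpos
        gcongr
    _ = ((1 / √(m : ℝ)) ^ K * √m ^ K) * (√(K ! : ℝ) *
          ((4 ^ n : ℝ)⁻¹ + K ^ 2 * (m : ℝ)⁻¹)) := by ring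
    _ = √(K ! : ℝ) * ((4 ^ n : ℝ)⁻¹ + K ^ 2 * (m : ℝ)⁻¹) := by rw [hpow, one_mul]
    _ ≤ √(K ! : ℝ) * ((1 + K) ^ 2 * ((m : ℝ)⁻¹ + (4 ^ n : ℝ)⁻¹)) := by
        gcongr
        have hK0 : (0 : ℝ) ≤ K := by positivity
        have ha : (0 : ℝ) ≤ (m : ℝ)⁻¹ := by positivity
        have hb : (0 : ℝ) ≤ (4 ^ n : ℝ)⁻¹ := by positivity
        nlinarith [mul_nonneg hK0 ha, mul_nonneg hK0 hb, mul_nonneg (mul_nonneg hK0 hK0) hb]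
    _ = _ := by ring

/-- Mixed moments of random Pauli sums are close to those of free semicircular variables. -/
theorem norm_traceMoment_sub_prod_le (hm : 0 < m) (L : List (List (Fin d))) {K : ℕ}
    (hK : L.flatten.length = K) :
    ‖traceMoment n m L - (L.map semicircularMoment).prod‖ ≤
      (1 + K) ^ 3 * √(K ! : ℝ) * ((m : ℝ)⁻¹ + (4 ^ n : ℝ)⁻¹) := by
  -- A splitting lowers the number of letters by two and raises the number of words by one;
  -- discarding an empty word lowers only the latter. The sum decreases in both cases.
  induction hN : K + L.length using Nat.strong_induction_on generalizing L K with
  | _ N ih =>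
    set ε := (m : ℝ)⁻¹ + (4 ^ n : ℝ)⁻¹ with hε
    have hε0 : 0 ≤ ε := by positivity
    match L, hK with
    | [], hK => simp; positivity
    | [] :: L, hK =>
      rw [traceMoment_nil_cons]
      simp only [List.map_cons, semicircularMoment_nil, List.prod_cons, one_mul]
      exact ih (K + L.length) (by simp at hN; omega) L (by simpa using hK) rfl
    | (i :: w) :: R, hK =>
      have h1 := norm_traceMoment_sub_splitSum_le (n := n) hm i w R hK
      have h2 : (splitSum i w fun u v => traceMoment n m (u :: v :: R)) -
          (((i :: w) :: R).map semicircularMoment).prod =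
          splitSum i w fun u v => traceMoment n m (u :: v :: R) -
            ((u :: v :: R).map semicircularMoment).prod := by
        rw [← splitSum_sub]
        congr 1
        rw [List.map_cons, List.prod_cons, semicircularMoment_cons]
        have := splitSum_map (AddMonoidHom.mulRight (R.map semicircularMoment).prod) i w
          fun u v => semicircularMoment u * semicircularMoment v
        simp only [AddMonoidHom.coe_mulRight] at this
        rw [this]
        simp only [List.map_cons, List.prod_cons, mul_assoc]
      have hKw : w.length + 1 ≤ K := by rw [← hK]; simp
      have h3 : ‖(splitSum i w fun u v => traceMoment n m (u :: v :: R)) -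
          (((i :: w) :: R).map semicircularMoment).prod‖ ≤ K * (1 + K) ^ 2 * √(K ! : ℝ) * ε := by
        rw [h2]
        rcases Nat.lt_or_ge K 2 with hK2 | hK2
        · obtain rfl : w = [] := List.length_eq_zero_iff.1 (by omega)
          rw [splitSum_nil, norm_zero]
          positivity
        obtain ⟨k, rfl⟩ : ∃ k, K = k + 2 := ⟨K - 2, by omega⟩
        refine (norm_splitSum_le _ _ _).trans ?_
        refine (splitSum_le (c := (1 + k) ^ 3 * √(k ! : ℝ) * ε) fun u v e => ?_).trans ?_
        · have hl : (u :: v :: R).flatten.length = k := by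
            have := hK; subst e; simp at this ⊢; omega
          exact ih (k + (u :: v :: R).length) (by simp at hN ⊢; omega) _ hl rfl
        · have hc : (w.count i : ℝ) ≤ k + 1 := by
            have : w.count i ≤ k + 1 := List.count_le_length.trans (by omega)
            exact_mod_cast this
          calc (w.count i : ℝ) * ((1 + k) ^ 3 * √(k ! : ℝ) * ε)
              ≤ (k + 1) * ((1 + k) ^ 3 * √(k ! : ℝ) * ε) := by gcongr
            _ = (1 + k) * (1 + k) ^ 2 * ((k + 1) * √(k ! : ℝ)) * ε := by ring
            _ ≤ ((k + 2 : ℕ) : ℝ) * (1 + (k + 2 : ℕ)) ^ 2 * √((k + 2)! : ℝ) * ε := by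
              gcongr ?_ * ?_ ^ 2 * ?_ * _
              · push_cast; linarith
              · push_cast; linarith
              · exact succ_mul_sqrt_factorial_le k
      have h4 := norm_sub_le_norm_sub_add_norm_sub (traceMoment n m ((i :: w) :: R))
        (splitSum i w fun u v => traceMoment n m (u :: v :: R))
        (((i :: w) :: R).map semicircularMoment).prod
      -- The new error and the inherited one add up because `(1 + K)^2 + K (1 + K)^2 = (1 + K)^3`,
      -- which explains the cubic prefactor.
      calc _ ≤ (1 + K) ^ 2 * √(K ! : ℝ) * ε + K * (1 + K) ^ 2 * √(K ! : ℝ) * ε := by linarith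
        _ = _ := by ring

end TraceMoment

end

noncomputable section

open scoped Nat Topology

/-! ### The total variation of the Stieltjes measures of a path -/

theorem iUnion_Ioc_neg_nat : (⋃ n : ℕ, Set.Ioc (-(n : ℝ)) n) = Set.univ := by
  refine Set.eq_univ_of_forall fun x => Set.mem_iUnion.2 ?_
  obtain ⟨n, hn⟩ := exists_nat_gt |x|
  exact ⟨n, (abs_lt.1 hn).1, (abs_lt.1 hn).2.le⟩

theorem monotone_Ioc_neg_nat : Monotone fun n : ℕ => Set.Ioc (-(n : ℝ)) n := fun a b h =>
  Set.Ioc_subset_Ioc (by simpa using h) (by simpa using h)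

theorem StieltjesFunction.measure_univ_le (F : StieltjesFunction ℝ) {c : ℝ}
    (h : ∀ a b, F b - F a ≤ c) : F.measure Set.univ ≤ ENNReal.ofReal c := by
  rw [← iUnion_Ioc_neg_nat, monotone_Ioc_neg_nat.measure_iUnion]
  refine iSup_le fun n => ?_
  rw [F.measure_Ioc]
  exact ENNReal.ofReal_le_ofReal (h _ _)

theorem variationOnFromTo_sub_le {f : ℝ → ℝ} (hf : BoundedVariationOn f Set.univ) (a b : ℝ) :
    variationOnFromTo f Set.univ 0 b - variationOnFromTo f Set.univ 0 a ≤
      (eVariationOn f Set.univ).toReal := by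
  rw [variationOnFromTo.sub_right hf.locallyBoundedVariationOn (Set.mem_univ _) (Set.mem_univ _)
    (Set.mem_univ _)]
  exact (le_abs_self _).trans (variationOnFromTo.abs_le_eVariationOn hf)

theorem sub_le_eVariationOn {f : ℝ → ℝ} (hf : BoundedVariationOn f Set.univ) (a b : ℝ) :
    f b - f a ≤ (eVariationOn f Set.univ).toReal :=
  hf.sub_le (Set.mem_univ b) (Set.mem_univ a)

/-- With `V` the cumulative variation of `f`, write `f = (V + f) - V` as a difference of monotone
functions. Their Stieltjes measures have masses at most `2ℓ` and `ℓ`, whence the factor `3`, which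
is not sharp but suffices. -/
theorem variation_vectorMeasure_univ_le {f : ℝ → ℝ} (hf : BoundedVariationOn f Set.univ)
    (hc : Continuous f) :
    hf.vectorMeasure.variation Set.univ ≤ ENNReal.ofReal (3 * (eVariationOn f Set.univ).toReal) := by
  set V := variationOnFromTo f Set.univ 0 with hV
  set ℓ := (eVariationOn f Set.univ).toReal with hℓ
  have hℓ0 : 0 ≤ ℓ := ENNReal.toReal_nonneg
  have hVc : ∀ x, ContinuousWithinAt V (Set.Ici x) x := fun x =>
    hf.continuousWithinAt_variationOnFromTo_Ici hc.continuousWithinAt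
  let q : StieltjesFunction ℝ :=
    { toFun := V
      mono' := monotoneOn_univ.1
        (variationOnFromTo.monotoneOn hf.locallyBoundedVariationOn (Set.mem_univ _))
      right_continuous' := hVc }
  let p : StieltjesFunction ℝ :=
    { toFun := V + f
      mono' := monotoneOn_univ.1
        (variationOnFromTo.add_self_monotoneOn hf.locallyBoundedVariationOn (Set.mem_univ _))
      right_continuous' := fun x => (hVc x).add hc.continuousWithinAt }
  have hq : q.measure Set.univ ≤ ENNReal.ofReal ℓ :=
    q.measure_univ_le fun a b => variationOnFromTo_sub_le hf a b
  have hp : p.measure Set.univ ≤ ENNReal.ofReal (2 * ℓ) := p.measure_univ_le fun a b => by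
    have h1 := variationOnFromTo_sub_le hf a b
    have h2 := sub_le_eVariationOn hf a b
    change V b + f b - (V a + f a) ≤ _
    linarith
  have : IsFiniteMeasure q.measure := ⟨hq.trans_lt ENNReal.ofReal_lt_top⟩
  have : IsFiniteMeasure p.measure := ⟨hp.trans_lt ENNReal.ofReal_lt_top⟩
  have hIoc : ∀ a b : ℝ, a ≤ b → hf.vectorMeasure (Set.Ioc a b) =
      (p.measure.toSignedMeasure - q.measure.toSignedMeasure) (Set.Ioc a b) := by
    intro a b hab
    rw [hf.vectorMeasure_Ioc hab, Measure.toSignedMeasure_sub_apply measurableSet_Ioc,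
      Measure.real, Measure.real, p.measure_Ioc, q.measure_Ioc,
      ENNReal.toReal_ofReal (sub_nonneg.2 (p.mono hab)),
      ENNReal.toReal_ofReal (sub_nonneg.2 (q.mono hab)),
      hc.continuousAt.continuousWithinAt.rightLim_eq, hc.continuousAt.continuousWithinAt.rightLim_eq]
    change _ = V b + f b - (V a + f a) - (V b - V a)
    ring
  -- Half-open intervals form a generating π-system; agreement on the whole line comes from
  -- exhausting it by such intervals.
  have heq : hf.vectorMeasure = p.measure.toSignedMeasure - q.measure.toSignedMeasure := by
    refine VectorMeasure.ext_of_generateFrom {s | ∃ u v : ℝ, u ≤ v ∧ s = Set.Ioc u v} ?_ ?_ ?_ ?_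
    · rintro _ ⟨u, v, huv, rfl⟩
      exact hIoc u v huv
    · rw [(inferInstance : BorelSpace ℝ).measurable_eq]
      convert! borel_eq_generateFrom_Ioc_le ℝ using 2
      grind only
    · rintro _ ⟨u, v, huv, rfl⟩ _ ⟨u', v', huv', rfl⟩ hne
      rw [Set.Ioc_inter_Ioc] at hne ⊢
      exact ⟨_, _, (Set.nonempty_Ioc.1 hne).le, rfl⟩
    · rw [← iUnion_Ioc_neg_nat]
      refine tendsto_nhds_unique
        (hf.vectorMeasure.tendsto_vectorMeasure_iUnion_atTop_nat monotone_Ioc_neg_nat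
          fun i => measurableSet_Ioc) ?_
      have := (p.measure.toSignedMeasure -
        q.measure.toSignedMeasure).tendsto_vectorMeasure_iUnion_atTop_nat monotone_Ioc_neg_nat
          fun i => measurableSet_Ioc
      refine this.congr fun n => (hIoc _ _ ?_).symm
      linarith [(Nat.cast_nonneg n : (0 : ℝ) ≤ n)]
  have hle : hf.vectorMeasure.variation ≤ p.measure + q.measure := by
    rw [heq]
    refine (VectorMeasure.variation_sub_le).trans ?_
    simp
  refine (hle Set.univ).trans ?_
  rw [Measure.add_apply]
  refine (add_le_add hp hq).trans ?_
  rw [← ENNReal.ofReal_add (by positivity) hℓ0]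
  exact ENNReal.ofReal_le_ofReal (by linarith)

namespace BVPath

variable {d : ℕ} {T : ℝ} (γ : BVPath d T)

theorem continuous_coord (j : Fin d) : Continuous (γ.coord j) := by
  have h1 : ContinuousOn (fun u => γ.toFun u j) (Set.Icc 0 T) :=
    (EuclideanSpace.proj (𝕜 := ℝ) j).continuous.comp_continuousOn γ.continuousOn
  exact h1.comp_continuous (f := fun u : ℝ => max 0 (min u T)) (by fun_prop)
    fun u => ⟨le_max_left _ _, max_le γ.T_nonneg (min_le_right _ _)⟩

theorem length_nonneg : 0 ≤ γ.length := ENNReal.toReal_nonneg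

/-- A coordinate is a `1`-Lipschitz image of the path, and clamping time to `[0, T]` is monotone;
neither increases variation. -/
theorem eVariationOn_coord_le (j : Fin d) :
    (eVariationOn (γ.coord j) Set.univ).toReal ≤ γ.length := by
  have hlip : LipschitzWith 1 (fun x : EuclideanSpace ℝ (Fin d) => x j) := by
    refine LipschitzWith.of_dist_le_mul fun x y => ?_
    have h := PiLp.norm_apply_le (x - y) j
    simpa [dist_eq_norm] using h
  have hmaps : Set.MapsTo (fun u : ℝ => max 0 (min u T)) Set.univ (Set.Icc 0 T) :=
    fun u _ => ⟨le_max_left _ _, max_le γ.T_nonneg (min_le_right _ _)⟩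
  have hmono : MonotoneOn (fun u : ℝ => max 0 (min u T)) Set.univ :=
    fun a _ b _ hab => max_le_max le_rfl (min_le_min hab le_rfl)
  refine ENNReal.toReal_mono γ.boundedVariationOn ?_
  refine (eVariationOn.comp_le_of_monotoneOn (fun u => γ.toFun u j) _ hmono hmaps).trans ?_
  have h := hlip.lipschitzOnWith.comp_eVariationOn_le (Set.mapsTo_univ γ.toFun (Set.Icc 0 T))
  rwa [ENNReal.coe_one, one_mul] at h

theorem dcoord_singleton (j : Fin d) (a : ℝ) : γ.dcoord j {a} = 0 := by
  rw [dcoord, BoundedVariationOn.vectorMeasure_singleton,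
    (γ.continuous_coord j).continuousAt.continuousWithinAt.rightLim_eq,
    (γ.continuous_coord j).continuousAt.continuousWithinAt.leftLim_eq, sub_self]

theorem variation_dcoord_univ_le (j : Fin d) :
    (γ.dcoord j).variation Set.univ ≤ ENNReal.ofReal (3 * γ.length) :=
  (variation_vectorMeasure_univ_le _ (γ.continuous_coord j)).trans
    (ENNReal.ofReal_le_ofReal (by linarith [γ.eVariationOn_coord_le j]))

instance instIsFiniteMeasureVariation (j : Fin d) : IsFiniteMeasure (γ.dcoord j).variation :=
  ⟨(γ.variation_dcoord_univ_le j).trans_lt ENNReal.ofReal_lt_top⟩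

instance instNullSingletonClassVariation (j : Fin d) : NullSingletonClass (γ.dcoord j).variation where
  measure_singleton a := by
    rw [VectorMeasure.variation_apply_eq_zero (measurableSet_singleton a)]
    intro t ht _
    rcases Set.subset_singleton_iff_eq.1 ht with rfl | rfl
    · simp
    · exact γ.dcoord_singleton j a

/-- The sum of the total variations of the coordinates of the path. -/
def speed : Measure ℝ := ∑ j, (γ.dcoord j).variation

instance instIsFiniteMeasureSpeed : IsFiniteMeasure γ.speed := by
  unfold speed; infer_instance

instance instNullSingletonClassSpeed : NullSingletonClass γ.speed where
  measure_singleton a := by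
    rw [speed, Measure.finsetSum_apply]
    exact Finset.sum_eq_zero fun j _ => measure_singleton a

theorem speed_univ_le : γ.speed.real Set.univ ≤ 3 * d * γ.length := by
  have h : γ.speed Set.univ ≤ ENNReal.ofReal (3 * d * γ.length) := by
    rw [speed, Measure.finsetSum_apply]
    refine (Finset.sum_le_sum fun j _ => γ.variation_dcoord_univ_le j).trans_eq ?_
    rw [Finset.sum_const, Finset.card_univ, Fintype.card_fin, nsmul_eq_mul,
      ← ENNReal.ofReal_natCast, ← ENNReal.ofReal_mul (by positivity)]
    ring_nf
  exact ENNReal.toReal_le_of_le_ofReal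
    (mul_nonneg (by positivity) γ.length_nonneg) h

end BVPath

end

noncomputable section

open scoped Nat Topology

/-! ### Powers of the distribution function of an atomless measure -/

section Primitive

variable (μ : Measure ℝ) [IsFiniteMeasure μ] [NullSingletonClass μ]

theorem continuousOn_real_Ioc (s t : ℝ) :
    ContinuousOn (fun u => μ.real (Set.Ioc s u)) (Set.Icc s t) := by
  have := intervalIntegral.continuousOn_primitive (μ := μ) (f := fun _ => (1 : ℝ)) (a := s) (b := t)
    (integrable_const _)
  simpa using this

/-- The probability integral transform: an atomless measure is carried to Lebesgue measure by its
own distribution function, which is continuous. -/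
theorem map_real_Ioc {s t : ℝ} (hst : s ≤ t) :
    (μ.restrict (Set.Ioc s t)).map (fun u => μ.real (Set.Ioc s u)) =
      volume.restrict (Set.Ioc 0 (μ.real (Set.Ioc s t))) := by
  set g : ℝ → ℝ := fun u => μ.real (Set.Ioc s u) with hg
  have hmono : Monotone g := fun a b hab => measureReal_mono (Set.Ioc_subset_Ioc_right hab)
  have hg0 : ∀ u, 0 ≤ g u := fun u => measureReal_nonneg
  refine Measure.ext_of_Iic _ _ fun a => ?_
  rw [Measure.map_apply hmono.measurable measurableSet_Iic,
    Measure.restrict_apply (hmono.measurable measurableSet_Iic),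
    Measure.restrict_apply measurableSet_Iic]
  change μ (g ⁻¹' Set.Iic a ∩ Set.Ioc s t) = volume (Set.Iic a ∩ Set.Ioc 0 (g t))
  rcases lt_or_ge a 0 with ha | ha
  · have h1 : g ⁻¹' Set.Iic a ∩ Set.Ioc s t = ∅ :=
      Set.eq_empty_of_forall_notMem fun u hu => (ha.trans_le (hg0 u)).not_ge hu.1
    have h2 : Set.Iic a ∩ Set.Ioc 0 (g t) = ∅ :=
      Set.eq_empty_of_forall_notMem fun u hu => (ha.trans hu.2.1).not_ge hu.1
    rw [h1, h2]; simp
  rcases le_or_gt (g t) a with hat | hat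
  · have h1 : g ⁻¹' Set.Iic a ∩ Set.Ioc s t = Set.Ioc s t :=
      Set.inter_eq_right.2 fun u hu => (hmono hu.2).trans hat
    have h2 : Set.Iic a ∩ Set.Ioc 0 (g t) = Set.Ioc 0 (g t) :=
      Set.inter_eq_right.2 fun u hu => hu.2.trans hat
    rw [h1, h2, Real.volume_Ioc, sub_zero, hg, ofReal_measureReal]
  · have hc : ContinuousOn g (Set.Icc s t) := continuousOn_real_Ioc μ s t
    have hgs : g s = 0 := by simp [hg]
    have hne : (Set.Icc s t ∩ g ⁻¹' {a}).Nonempty := by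
      obtain ⟨u, hu, hua⟩ := intermediate_value_Icc hst hc ⟨hgs.le.trans ha, hat.le⟩
      exact ⟨u, hu, hua⟩
    -- The distribution function may be flat, so the last point `u` of its level set is taken; the
    -- sublevel set is then exactly `(s, u]`.
    have hcomp : IsCompact (Set.Icc s t ∩ g ⁻¹' {a}) :=
      isCompact_Icc.of_isClosed_subset (hc.preimage_isClosed_of_isClosed isClosed_Icc
        isClosed_singleton) Set.inter_subset_left
    obtain ⟨u, ⟨hu, hua⟩, hmax⟩ := hcomp.exists_isGreatest hne
    have hua : g u = a := hua
    have h1 : g ⁻¹' Set.Iic a ∩ Set.Ioc s t = Set.Ioc s u := by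
      ext v
      simp only [Set.mem_inter_iff, Set.mem_preimage, Set.mem_Iic, Set.mem_Ioc]
      constructor
      · rintro ⟨hv, hsv, hvt⟩
        refine ⟨hsv, le_of_not_gt fun huv => ?_⟩
        exact huv.not_ge (hmax ⟨⟨hsv.le, hvt⟩, le_antisymm hv (hua.symm.le.trans (hmono huv.le))⟩)
      · rintro ⟨hsv, hvu⟩
        exact ⟨(hmono hvu).trans hua.le, hsv, hvu.trans hu.2⟩
    have h2 : Set.Iic a ∩ Set.Ioc 0 (g t) = Set.Ioc 0 a := by
      ext v
      simp only [Set.mem_inter_iff, Set.mem_Iic, Set.mem_Ioc]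
      constructor
      · rintro ⟨h, h', -⟩; exact ⟨h', h⟩
      · rintro ⟨h, h'⟩; exact ⟨h', h, h'.trans hat.le⟩
    rw [h1, h2, Real.volume_Ioc, sub_zero, ← hua, hg, ofReal_measureReal]

/-- Transported to Lebesgue measure, this is the integral of `y^k / k!`. It makes iterated Stieltjes
integrals gain the factor `1 / k!`. -/
theorem lintegral_real_Ioc_pow {s t : ℝ} (hst : s ≤ t) (k : ℕ) :
    ∫⁻ u in Set.Ioc s t, ENNReal.ofReal (μ.real (Set.Ioc s u) ^ k / k !) ∂μ =
      ENNReal.ofReal (μ.real (Set.Ioc s t) ^ (k + 1) / (k + 1)!) := by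
  have hmono : Monotone fun u => μ.real (Set.Ioc s u) :=
    fun a b hab => measureReal_mono (Set.Ioc_subset_Ioc_right hab)
  have h := lintegral_map (μ := μ.restrict (Set.Ioc s t))
    (f := fun y : ℝ => ENNReal.ofReal (y ^ k / k !)) (by fun_prop) hmono.measurable
  rw [← h, map_real_Ioc μ hst, ← ofReal_integral_eq_lintegral_ofReal]
  · rw [← intervalIntegral.integral_of_le measureReal_nonneg, intervalIntegral.integral_div,
      integral_pow, Nat.factorial_succ]
    push_cast
    congr 1
    simp only [ne_eq, Nat.add_eq_zero_iff, one_ne_zero, and_false, not_false_eq_true, zero_pow,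
      sub_zero]
    field_simp
  · exact (Continuous.integrableOn_Icc (by fun_prop)).mono_set Set.Ioc_subset_Icc_self
  · filter_upwards [ae_restrict_mem measurableSet_Ioc] with y hy
    have := hy.1.le
    simp only [Pi.zero_apply]
    positivity

end Primitive

/-! ### Stieltjes integrals along a path -/

theorem integrableOn_Ioc_of_continuousOn {E : Type*} [NormedAddCommGroup E] {s T' t : ℝ}
    (ht : t ≤ T') {f : ℝ → E}
    (hf : ContinuousOn f (Set.Icc s T')) (μ : Measure ℝ) [IsFiniteMeasure μ] :
    IntegrableOn f (Set.Ioc s t) μ :=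
  (hf.integrableOn_Icc).mono_set fun _ hu => ⟨hu.1.le, hu.2.trans ht⟩

namespace BVPath

variable {d : ℕ} {T : ℝ} (γ : BVPath d T)

/-- The speed of the path accumulated on `(s, t]`. -/
def arc (s t : ℝ) : ℝ := γ.speed.real (Set.Ioc s t)

theorem arc_nonneg (s t : ℝ) : 0 ≤ γ.arc s t := measureReal_nonneg

theorem arc_le (s t : ℝ) : γ.arc s t ≤ 3 * d * γ.length :=
  (measureReal_mono (Set.subset_univ _)).trans γ.speed_univ_le

theorem restrict_speed (S : Set ℝ) :
    γ.speed.restrict S = ∑ j, (γ.dcoord j).variation.restrict S := by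
  simpa only [speed, Measure.restrictₗ_apply] using map_sum (Measure.restrictₗ S) (fun j => (γ.dcoord j).variation) Finset.univ

variable {E : Type*} [NormedAddCommGroup E] [NormedSpace ℝ E]

/-- One step of Picard iteration. Summing over the coordinates before estimating turns their
variations into the single measure `speed`, so that no factor `d` is lost per step. -/
theorem sum_norm_integral_le {s t : ℝ} (hst : s ≤ t) {f : Fin d → ℝ → E} {c : ℝ} (hc : 0 ≤ c)
    (k : ℕ) (hf : ∀ j, ∀ u ∈ Set.Ioc s t, ‖f j u‖ ≤ c * (γ.arc s u ^ k / k !)) :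
    ∑ j, ‖∫ᵛ u in Set.Ioc s t, f j u ∂<•(γ.dcoord j)‖ ≤
      c * (γ.arc s t ^ (k + 1) / (k + 1)!) := by
  rcases subsingleton_or_nontrivial E with hE | hE
  · simp only [norm_of_subsingleton, Finset.sum_const_zero]
    have := γ.arc_nonneg s t
    positivity
  have h : ∀ j, ‖∫ᵛ u in Set.Ioc s t, f j u ∂<•(γ.dcoord j)‖ₑ ≤
      ∫⁻ u in Set.Ioc s t, ENNReal.ofReal (c * (γ.arc s u ^ k / k !)) ∂(γ.dcoord j).variation := by
    intro j
    refine VectorMeasure.enorm_setIntegral_le_lintegral_enorm_transpose.trans ?_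
    rw [VectorMeasure.variation_transpose_lsmul_flip]
    refine setLIntegral_mono' measurableSet_Ioc fun u hu => ?_
    rw [← ofReal_norm]
    exact ENNReal.ofReal_le_ofReal (hf j u hu)
  have h2 : ∑ j, ‖∫ᵛ u in Set.Ioc s t, f j u ∂<•(γ.dcoord j)‖ₑ ≤
      ENNReal.ofReal (c * (γ.arc s t ^ (k + 1) / (k + 1)!)) := by
    refine (Finset.sum_le_sum fun j _ => h j).trans_eq ?_
    rw [← lintegral_finsetSum_measure, ← restrict_speed]
    simp only [ENNReal.ofReal_mul hc]
    rw [lintegral_const_mul' _ _ ENNReal.ofReal_ne_top]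
    congr 1
    exact lintegral_real_Ioc_pow γ.speed hst k
  have h3 : ∑ j, ‖∫ᵛ u in Set.Ioc s t, f j u ∂<•(γ.dcoord j)‖ₑ =
      ENNReal.ofReal (∑ j, ‖∫ᵛ u in Set.Ioc s t, f j u ∂<•(γ.dcoord j)‖) := by
    rw [ENNReal.ofReal_sum_of_nonneg fun _ _ => norm_nonneg _]
    simp only [ofReal_norm]
  rw [h3] at h2
  refine (ENNReal.ofReal_le_ofReal_iff ?_).1 h2
  have := γ.arc_nonneg s t
  positivity

theorem norm_integral_le {s t : ℝ} (hst : s ≤ t) (j : Fin d) {f : ℝ → E} {c : ℝ} (hc : 0 ≤ c)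
    (k : ℕ) (hf : ∀ u ∈ Set.Ioc s t, ‖f u‖ ≤ c * (γ.arc s u ^ k / k !)) :
    ‖∫ᵛ u in Set.Ioc s t, f u ∂<•(γ.dcoord j)‖ ≤ c * (γ.arc s t ^ (k + 1) / (k + 1)!) :=
  (Finset.single_le_sum (f := fun j => ‖∫ᵛ u in Set.Ioc s t, f u ∂<•(γ.dcoord j)‖)
    (fun _ _ => norm_nonneg _) (Finset.mem_univ j)).trans
    (γ.sum_norm_integral_le hst hc k fun _ => hf)

theorem norm_sigRev_le (s : ℝ) (w : List (Fin d)) {t : ℝ} (hst : s ≤ t) :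
    ‖γ.sigRev s w t‖ ≤ γ.arc s t ^ w.length / w.length ! := by
  induction w generalizing t with
  | nil => simp [sigRev]
  | cons j w ih =>
    have := γ.norm_integral_le hst j (f := γ.sigRev s w) zero_le_one w.length
      fun u hu => (ih hu.1.le).trans_eq (one_mul _).symm
    rwa [one_mul] at this

theorem norm_sigRev_le' (s : ℝ) (w : List (Fin d)) {t : ℝ} (hst : s ≤ t) :
    ‖γ.sigRev s w t‖ ≤ (3 * d * γ.length) ^ w.length / w.length ! := by
  refine (γ.norm_sigRev_le s w hst).trans ?_
  gcongr
  · exact γ.arc_nonneg s t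
  · exact γ.arc_le s t

/-- The positive part of `dγ^j`. -/
def dpos (j : Fin d) : Measure ℝ := (γ.dcoord j).toJordanDecomposition.posPart

/-- The negative part of `dγ^j`. -/
def dneg (j : Fin d) : Measure ℝ := (γ.dcoord j).toJordanDecomposition.negPart

instance instIsFiniteMeasureDpos (j : Fin d) : IsFiniteMeasure (γ.dpos j) := by
  unfold dpos; infer_instance

instance instIsFiniteMeasureDneg (j : Fin d) : IsFiniteMeasure (γ.dneg j) := by
  unfold dneg; infer_instance

theorem dpos_add_dneg (j : Fin d) : γ.dpos j + γ.dneg j = (γ.dcoord j).variation :=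
  (γ.dcoord j).totalVariation_eq_variation

instance instNullSingletonClassDpos (j : Fin d) : NullSingletonClass (γ.dpos j) where
  measure_singleton a := by
    have h : (γ.dpos j + γ.dneg j) {a} = 0 := by rw [dpos_add_dneg]; exact measure_singleton a
    exact (add_eq_zero.1 h).1

instance instNullSingletonClassDneg (j : Fin d) : NullSingletonClass (γ.dneg j) where
  measure_singleton a := by
    have h : (γ.dpos j + γ.dneg j) {a} = 0 := by rw [dpos_add_dneg]; exact measure_singleton a
    exact (add_eq_zero.1 h).2

theorem dcoord_eq (j : Fin d) :
    γ.dcoord j = (γ.dpos j).toSignedMeasure - (γ.dneg j).toSignedMeasure :=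
  (γ.dcoord j).toSignedMeasure_toJordanDecomposition.symm

/-- The Jordan decomposition reduces continuity, linearity and interchange with series to integrals
against finite positive measures. -/
theorem integral_eq_sub {s t : ℝ} (j : Fin d) {f : ℝ → E} {T' : ℝ} (ht : t ≤ T')
    (hf : ContinuousOn f (Set.Icc s T')) :
    ∫ᵛ u in Set.Ioc s t, f u ∂<•(γ.dcoord j) =
      ∫ u in Set.Ioc s t, f u ∂(γ.dpos j) - ∫ u in Set.Ioc s t, f u ∂(γ.dneg j) := by
  have h : (γ.dcoord j).restrict (Set.Ioc s t) =
      ((γ.dpos j).restrict (Set.Ioc s t)).toSignedMeasure -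
        ((γ.dneg j).restrict (Set.Ioc s t)).toSignedMeasure := by
    rw [dcoord_eq, VectorMeasure.restrict_sub, VectorMeasure.restrict_toSignedMeasure
      measurableSet_Ioc, VectorMeasure.restrict_toSignedMeasure measurableSet_Ioc]
  rw [h, VectorMeasure.integral_sub_vectorMeasure, VectorMeasure.integral_toSignedMeasure,
    VectorMeasure.integral_toSignedMeasure]
  · rw [VectorMeasure.Integrable, Measure.variation_toSignedMeasure]
    exact integrableOn_Ioc_of_continuousOn ht hf _
  · rw [VectorMeasure.Integrable, Measure.variation_toSignedMeasure]
    exact integrableOn_Ioc_of_continuousOn ht hf _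

theorem continuousOn_integral (j : Fin d) {s T' : ℝ} {f : ℝ → E}
    (hf : ContinuousOn f (Set.Icc s T')) :
    ContinuousOn (fun t => ∫ᵛ u in Set.Ioc s t, f u ∂<•(γ.dcoord j)) (Set.Icc s T') := by
  refine ContinuousOn.congr (f := fun t => ∫ u in Set.Ioc s t, f u ∂(γ.dpos j) -
    ∫ u in Set.Ioc s t, f u ∂(γ.dneg j)) ?_ fun t ht => γ.integral_eq_sub j ht.2 hf
  exact (intervalIntegral.continuousOn_primitive hf.integrableOn_Icc).sub
    (intervalIntegral.continuousOn_primitive hf.integrableOn_Icc)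

theorem continuousOn_sigRev (s T' : ℝ) (w : List (Fin d)) :
    ContinuousOn (γ.sigRev s w) (Set.Icc s T') := by
  induction w with
  | nil => exact continuousOn_const
  | cons j w ih => exact γ.continuousOn_integral j ih

theorem integral_mul_ofReal (j : Fin d) {s t T' : ℝ} (ht : t ≤ T') {f : ℝ → ℝ}
    (hf : ContinuousOn f (Set.Icc s T')) (c : ℂ) :
    ∫ᵛ u in Set.Ioc s t, (c * (f u : ℂ)) ∂<•(γ.dcoord j) =
      c * ((∫ᵛ u in Set.Ioc s t, f u ∂<•(γ.dcoord j) : ℝ) : ℂ) := by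
  have hc : ContinuousOn (fun u => c * (f u : ℂ)) (Set.Icc s T') :=
    continuousOn_const.mul (Complex.continuous_ofReal.comp_continuousOn hf)
  rw [γ.integral_eq_sub j ht hf, γ.integral_eq_sub j ht hc,
    integral_const_mul, integral_const_mul, integral_complex_ofReal, integral_complex_ofReal]
  push_cast
  ring

theorem hasSum_integral [CompleteSpace E] {ι : Type*} [Countable ι] (j : Fin d) {s t T' : ℝ}
    (ht : t ≤ T')
    {F : ι → ℝ → E} {b : ι → ℝ} (hF : ∀ i, ContinuousOn (F i) (Set.Icc s T'))
    (hb : ∀ i, ∀ u ∈ Set.Icc s T', ‖F i u‖ ≤ b i) (hs : Summable b) :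
    HasSum (fun i => ∫ᵛ u in Set.Ioc s t, F i u ∂<•(γ.dcoord j))
      (∫ᵛ u in Set.Ioc s t, ∑' i, F i u ∂<•(γ.dcoord j)) := by
  have hsub : Set.Ioc s t ⊆ Set.Icc s T' := fun u hu => ⟨hu.1.le, hu.2.trans ht⟩
  have h : ∀ (μ : Measure ℝ) [IsFiniteMeasure μ],
      HasSum (fun i => ∫ u in Set.Ioc s t, F i u ∂μ) (∫ u in Set.Ioc s t, ∑' i, F i u ∂μ) := by
    intro μ _
    refine hasSum_integral_of_dominated_convergence (fun i _ => b i)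
      (fun i => (integrableOn_Ioc_of_continuousOn ht (hF i) μ).aestronglyMeasurable) (fun i => ?_)
      (Filter.Eventually.of_forall fun _ => hs) (integrable_const _) ?_
    · filter_upwards [ae_restrict_mem measurableSet_Ioc] with u hu using hb i u (hsub hu)
    · filter_upwards [ae_restrict_mem measurableSet_Ioc] with u hu
      exact (Summable.of_norm_bounded hs fun i => hb i u (hsub hu)).hasSum
  rw [γ.integral_eq_sub j ht (continuousOn_tsum hF hs hb)]
  simp only [γ.integral_eq_sub j ht (hF _)]
  exact (h _).sub (h _)

end BVPath

end

noncomputable section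

open scoped Nat Topology

/-! ### Sums over words -/

/-- There are `d^k` words of length `k`; the sum is taken along the fibres of the length. -/
theorem hasSum_length {d : ℕ} {a : ℕ → ℝ} (ha : ∀ k, 0 ≤ a k)
    (h : Summable fun k => (d : ℝ) ^ k * a k) :
    HasSum (fun w : List (Fin d) => a w.length) (∑' k, (d : ℝ) ^ k * a k) := by
  let e : (Σ k, {w : List (Fin d) // w.length = k}) ≃ List (Fin d) :=
    Equiv.sigmaFiberEquiv List.length
  have hfib : ∀ k, HasSum (fun w : {w : List (Fin d) // w.length = k} => a w.1.length)
      ((d : ℝ) ^ k * a k) := by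
    intro k
    have h1 : (fun w : {w : List (Fin d) // w.length = k} => a w.1.length) = fun _ => a k :=
      funext fun w => by rw [w.2]
    let _ : Fintype {w : List (Fin d) // w.length = k} :=
      inferInstanceAs (Fintype (List.Vector (Fin d) k))
    have hcard : Fintype.card {w : List (Fin d) // w.length = k} = d ^ k := by
      have := card_vector (α := Fin d) k
      rwa [Fintype.card_fin] at this
    rw [h1]
    convert! hasSum_fintype (fun _ : {w : List (Fin d) // w.length = k} => a k) using 1
    simp [hcard]
  rw [← e.hasSum_iff]
  refine HasSum.sigma_of_hasSum h.hasSum hfib ?_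
  refine (summable_sigma_of_nonneg fun x => ha _).2 ⟨fun k => (hfib k).summable, ?_⟩
  exact h.congr fun k => (hfib k).tsum_eq.symm

/-- A list is either empty or a head together with a tail. -/
def listEquivSum (α : Type*) : Unit ⊕ (α × List α) ≃ List α where
  toFun := Sum.elim (fun _ => []) fun p => p.1 :: p.2
  invFun l := match l with
    | [] => Sum.inl ()
    | a :: l => Sum.inr (a, l)
  left_inv o := by rcases o with _ | _ <;> rfl
  right_inv l := by cases l <;> rfl

theorem tsum_list {d : ℕ} {f : List (Fin d) → ℂ} (hf : Summable f) :
    ∑' w, f w = f [] + ∑ j, ∑' w, f (j :: w) := by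
  have h1 : Summable (f ∘ listEquivSum (Fin d)) := (listEquivSum (Fin d)).summable_iff.2 hf
  have h2 : Summable ((f ∘ listEquivSum (Fin d)) ∘ Sum.inr) :=
    h1.comp_injective Sum.inr_injective
  rw [← (listEquivSum (Fin d)).tsum_eq]
  refine (Summable.tsum_sum (f := f ∘ listEquivSum (Fin d))
    (h1.comp_injective Sum.inl_injective) h2).trans ?_
  congr 1
  · exact (tsum_fintype (fun _ : Unit => f [])).trans (by simp)
  · exact h2.tsum_prod.trans (tsum_fintype _)

/-! ### Existence and uniqueness of developments -/

section Development

variable {d n : ℕ} {T : ℝ} (γ : BVPath d T) (A : Fin d → QubitMatrix n)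

/-- A bound for the norms of the matrices `A j` as operators for the entrywise supremum norm. -/
def entryBound : ℝ := Fintype.card (Fin n → Fin 2) * ∑ j, ∑ a, ∑ b, ‖A j a b‖

theorem entryBound_nonneg : 0 ≤ entryBound A := by
  unfold entryBound; positivity

/-- Right multiplication acts on each row separately, so a bound on row `a` propagates along a
product. -/
theorem norm_mul_entry_le {B : QubitMatrix n} {c : ℝ} {a : Fin n → Fin 2}
    (hB : ∀ b, ‖B a b‖ ≤ c) (j : Fin d) (b : Fin n → Fin 2) :
    ‖(B * A j) a b‖ ≤ c * entryBound A := by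
  have hc : 0 ≤ c := (norm_nonneg _).trans (hB b)
  have hA : ∀ e b, ‖A j e b‖ ≤ ∑ j, ∑ a, ∑ b, ‖A j a b‖ := fun e b =>
    ((Finset.single_le_sum (f := fun b => ‖A j e b‖) (fun _ _ => norm_nonneg _)
      (Finset.mem_univ b)).trans
    (Finset.single_le_sum (f := fun e => ∑ b, ‖A j e b‖)
      (fun _ _ => Finset.sum_nonneg fun _ _ => norm_nonneg _) (Finset.mem_univ e))).trans
    (Finset.single_le_sum (f := fun j => ∑ e, ∑ b, ‖A j e b‖)
      (fun _ _ => Finset.sum_nonneg fun _ _ => Finset.sum_nonneg fun _ _ => norm_nonneg _)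
      (Finset.mem_univ j))
  rw [Matrix.mul_apply]
  refine (norm_sum_le _ _).trans ((Finset.sum_le_sum fun e _ =>
    (norm_mul_le _ _).trans (mul_le_mul (hB e) (hA e b) (norm_nonneg _) hc)).trans_eq ?_)
  rw [Finset.sum_const, Finset.card_univ, nsmul_eq_mul, entryBound]
  ring

theorem matWord_reverse_cons (j : Fin d) (v : List (Fin d)) :
    matWord A (j :: v).reverse = matWord A v.reverse * A j := by simp [matWord]

theorem norm_matWord_reverse_le (v : List (Fin d)) (a b : Fin n → Fin 2) :
    ‖matWord A v.reverse a b‖ ≤ entryBound A ^ v.length := by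
  induction v generalizing b with
  | nil =>
    rw [List.reverse_nil, matWord_nil, Matrix.one_apply]
    split_ifs <;> simp
  | cons j v ih =>
    rw [matWord_reverse_cons, List.length_cons, pow_succ]
    exact norm_mul_entry_le A ih j b

/-- The term of the series solution of the development equation, indexed by reversed words. -/
def devTerm (s : ℝ) (v : List (Fin d)) (u : ℝ) : QubitMatrix n :=
  (Complex.I ^ v.length * (γ.sigRev s v u : ℂ)) • matWord A v.reverse

/-- The bound for `devTerm` on words of length `k`. -/
def devBound (k : ℕ) : ℝ := (3 * d * γ.length * entryBound A) ^ k / k !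

theorem devBound_nonneg (k : ℕ) : 0 ≤ devBound γ A k := by
  have := γ.length_nonneg
  have := entryBound_nonneg A
  unfold devBound; positivity

theorem summable_devBound : Summable fun v : List (Fin d) => devBound γ A v.length := by
  refine (hasSum_length (devBound_nonneg γ A) ?_).summable
  refine (Real.summable_pow_div_factorial (d * (3 * d * γ.length * entryBound A))).congr fun k => ?_
  rw [devBound, mul_pow, mul_div_assoc]

theorem norm_devTerm_le {s u : ℝ} (hu : s ≤ u) (v : List (Fin d)) (a b : Fin n → Fin 2) :
    ‖devTerm γ A s v u a b‖ ≤ devBound γ A v.length := by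
  rw [devTerm, Matrix.smul_apply, smul_eq_mul, norm_mul, norm_mul, norm_pow, Complex.norm_I,
    one_pow, one_mul, Complex.norm_real, devBound, mul_pow, mul_div_right_comm]
  exact mul_le_mul (γ.norm_sigRev_le' s v hu) (norm_matWord_reverse_le A v a b) (norm_nonneg _)
    (by have := γ.length_nonneg; positivity)

theorem continuousOn_devTerm (s T' : ℝ) (v : List (Fin d)) (a b : Fin n → Fin 2) :
    ContinuousOn (fun u => devTerm γ A s v u a b) (Set.Icc s T') := by
  simp only [devTerm, Matrix.smul_apply, smul_eq_mul]
  exact (continuousOn_const.mul (Complex.continuous_ofReal.comp_continuousOn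
    (γ.continuousOn_sigRev s T' v))).mul continuousOn_const

/-- The series solution of the development equation. -/
def devSeries (s u : ℝ) : QubitMatrix n := Matrix.of fun a b => ∑' v, devTerm γ A s v u a b

theorem summable_devTerm {s u : ℝ} (hu : s ≤ u) (a b : Fin n → Fin 2) :
    Summable fun v => devTerm γ A s v u a b :=
  Summable.of_norm_bounded (summable_devBound γ A) fun v => norm_devTerm_le γ A hu v a b

/-- Words are stored reversed: the new head `j` is both the outermost integral and the rightmost
matrix factor, as in `dU = i U A dγ`. -/
theorem devTerm_cons {s t T' : ℝ} (ht : t ≤ T') (j : Fin d) (v : List (Fin d))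
    (a b : Fin n → Fin 2) : devTerm γ A s (j :: v) t a b =
      Complex.I * ∫ᵛ u in Set.Ioc s t, (devTerm γ A s v u * A j) a b ∂<•(γ.dcoord j) := by
  have h : ∀ u, (devTerm γ A s v u * A j) a b =
      (Complex.I ^ v.length * (matWord A v.reverse * A j) a b) * (γ.sigRev s v u : ℂ) := by
    intro u
    rw [devTerm, Matrix.smul_mul, Matrix.smul_apply, smul_eq_mul]
    ring
  simp only [h]
  rw [γ.integral_mul_ofReal j ht (γ.continuousOn_sigRev s T' v), devTerm, matWord_reverse_cons,
    Matrix.smul_apply, smul_eq_mul, List.length_cons, pow_succ]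
  change _ * ((γ.sigRev s (j :: v) t : ℝ) : ℂ) * _ = _
  rw [BVPath.sigRev]
  ring

theorem continuousOn_devTerm_mul (s T' : ℝ) (j : Fin d) (v : List (Fin d))
    (a b : Fin n → Fin 2) :
    ContinuousOn (fun u => (devTerm γ A s v u * A j) a b) (Set.Icc s T') := by
  simp only [Matrix.mul_apply]
  exact continuousOn_finsetSum _ fun c _ =>
    (continuousOn_devTerm γ A s T' v a c).mul continuousOn_const

theorem norm_devTerm_mul_le {s u : ℝ} (hu : s ≤ u) (j : Fin d) (v : List (Fin d))
    (a b : Fin n → Fin 2) :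
    ‖(devTerm γ A s v u * A j) a b‖ ≤ devBound γ A v.length * entryBound A :=
  norm_mul_entry_le A (fun c => norm_devTerm_le γ A hu v a c) j b

theorem continuousOn_devSeries (s T' : ℝ) (a b : Fin n → Fin 2) :
    ContinuousOn (fun u => devSeries γ A s u a b) (Set.Icc s T') :=
  continuousOn_tsum (fun v => continuousOn_devTerm γ A s T' v a b) (summable_devBound γ A)
    fun v _ hu => norm_devTerm_le γ A hu.1 v a b

theorem continuousOn_devSeries_mul (s T' : ℝ) (j : Fin d) (a b : Fin n → Fin 2) :
    ContinuousOn (fun u => (devSeries γ A s u * A j) a b) (Set.Icc s T') := by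
  simp only [Matrix.mul_apply]
  exact continuousOn_finsetSum _ fun c _ =>
    (continuousOn_devSeries γ A s T' a c).mul continuousOn_const

theorem tsum_devTerm_mul {s u : ℝ} (hu : s ≤ u) (j : Fin d) (a b : Fin n → Fin 2) :
    ∑' v, (devTerm γ A s v u * A j) a b = (devSeries γ A s u * A j) a b := by
  simp only [Matrix.mul_apply]
  rw [Summable.tsum_finsetSum fun c _ => (summable_devTerm γ A hu a c).mul_right _]
  simp only [tsum_mul_right]
  rfl

theorem tsum_devTerm_cons {s t T' : ℝ} (ht : t ≤ T') (j : Fin d) (a b : Fin n → Fin 2) :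
    ∑' v, devTerm γ A s (j :: v) t a b =
      Complex.I * ∫ᵛ u in Set.Ioc s t, (devSeries γ A s u * A j) a b ∂<•(γ.dcoord j) := by
  have hF : ∀ v, ContinuousOn (fun u => (devTerm γ A s v u * A j) a b) (Set.Icc s T') :=
    fun v => continuousOn_devTerm_mul γ A s T' j v a b
  have hb : ∀ v, ∀ u ∈ Set.Icc s T', ‖(devTerm γ A s v u * A j) a b‖ ≤
      devBound γ A v.length * entryBound A :=
    fun v u hu => norm_devTerm_mul_le γ A hu.1 j v a b
  have hs : Summable fun v : List (Fin d) => devBound γ A v.length * entryBound A :=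
    (summable_devBound γ A).mul_right _
  simp only [devTerm_cons γ A ht]
  rw [tsum_mul_left, (γ.hasSum_integral j ht hF hb hs).tsum_eq]
  have h : ∀ u ∈ Set.Ioc s t, ∑' v, (devTerm γ A s v u * A j) a b =
      (devSeries γ A s u * A j) a b := fun u hu => tsum_devTerm_mul γ A hu.1.le j a b
  rw [γ.integral_eq_sub j ht (continuousOn_devSeries_mul γ A s T' j a b),
    γ.integral_eq_sub j ht (continuousOn_tsum hF hs hb),
    setIntegral_congr_fun measurableSet_Ioc h, setIntegral_congr_fun measurableSet_Ioc h]

theorem isDevelopment_devSeries (s : ℝ) : γ.IsDevelopment A s (devSeries γ A s) where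
  continuousOn :=
    continuousOn_pi.2 fun a => continuousOn_pi.2 fun b => continuousOn_devSeries γ A s T a b
  eq := by
    intro t ht a b
    have h0 : devTerm γ A s [] t a b = (1 : QubitMatrix n) a b := by
      simp [devTerm, BVPath.sigRev]
    change ∑' v, devTerm γ A s v t a b = _
    rw [tsum_list (summable_devTerm γ A ht.1 a b), h0, Finset.mul_sum]
    simp only [tsum_devTerm_cons γ A ht.2]

variable {γ A}

theorem BVPath.IsDevelopment.continuousOn_entry {s : ℝ} {U : ℝ → QubitMatrix n}
    (hU : γ.IsDevelopment A s U) (a b : Fin n → Fin 2) :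
    ContinuousOn (fun u => U u a b) (Set.Icc s T) :=
  continuousOn_pi.1 (continuousOn_pi.1 hU.continuousOn a) b

theorem BVPath.IsDevelopment.continuousOn_mul_entry {s : ℝ} {U : ℝ → QubitMatrix n}
    (hU : γ.IsDevelopment A s U) (j : Fin d) (a b : Fin n → Fin 2) :
    ContinuousOn (fun u => (U u * A j) a b) (Set.Icc s T) := by
  simp only [Matrix.mul_apply]
  exact continuousOn_finsetSum _ fun c _ => (hU.continuousOn_entry a c).mul continuousOn_const

/-- The difference of two solutions solves the homogeneous equation. Inserting a bound into it
repeatedly improves the bound by one power and one factorial each time. -/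
theorem BVPath.IsDevelopment.norm_sub_le {s : ℝ} {U U' : ℝ → QubitMatrix n}
    (hU : γ.IsDevelopment A s U) (hU' : γ.IsDevelopment A s U') {M : ℝ} (hM0 : 0 ≤ M)
    (hM : ∀ t ∈ Set.Icc s T, ∀ a b, ‖U t a b - U' t a b‖ ≤ M) (k : ℕ) {t : ℝ}
    (ht : t ∈ Set.Icc s T) (a b : Fin n → Fin 2) :
    ‖U t a b - U' t a b‖ ≤ M * entryBound A ^ k * (γ.arc s t ^ k / k !) := by
  induction k generalizing t a b with
  | zero => simpa using hM t ht a b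
  | succ k ih =>
    have h : U t a b - U' t a b = Complex.I *
        ∑ j, ∫ᵛ u in Set.Ioc s t, ((U u - U' u) * A j) a b ∂<•(γ.dcoord j) := by
      rw [hU.eq t ht, hU'.eq t ht, add_sub_add_left_eq_sub, ← mul_sub, ← Finset.sum_sub_distrib]
      congr 1
      refine Finset.sum_congr rfl fun j _ => ?_
      have h1 := hU.continuousOn_mul_entry j a b
      have h2 := hU'.continuousOn_mul_entry j a b
      have h3 : ∀ u, ((U u - U' u) * A j) a b = (U u * A j) a b - (U' u * A j) a b := fun u => by
        rw [Matrix.sub_mul, Matrix.sub_apply]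
      simp only [h3]
      have h4 : ContinuousOn (fun u => (U u * A j) a b - (U' u * A j) a b) (Set.Icc s T) :=
        h1.sub h2
      rw [γ.integral_eq_sub j ht.2 h1, γ.integral_eq_sub j ht.2 h2,
        γ.integral_eq_sub j ht.2 h4, integral_sub, integral_sub]
      · ring
      all_goals exact integrableOn_Ioc_of_continuousOn ht.2 (by assumption) _
    rw [h, norm_mul, Complex.norm_I, one_mul]
    refine (norm_sum_le _ _).trans ?_
    refine γ.sum_norm_integral_le ht.1 (mul_nonneg hM0 (pow_nonneg (entryBound_nonneg A) _)) k
      fun j u hu => ?_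
    refine (norm_mul_entry_le A (fun c => ih (t := u) ⟨hu.1.le, hu.2.trans ht.2⟩ a c)
      j b).trans_eq ?_
    ring

theorem BVPath.IsDevelopment.eqOn {s : ℝ} {U U' : ℝ → QubitMatrix n}
    (hU : γ.IsDevelopment A s U) (hU' : γ.IsDevelopment A s U') :
    Set.EqOn U U' (Set.Icc s T) := by
  have hbd : ∀ a b, ∃ M, ∀ t ∈ Set.Icc s T, ‖U t a b - U' t a b‖ ≤ M := fun a b =>
    isCompact_Icc.exists_bound_of_continuousOn
      ((hU.continuousOn_entry a b).sub (hU'.continuousOn_entry a b))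
  choose M hM using hbd
  intro t ht
  ext a b
  set M' := ∑ a, ∑ b, |M a b| with hM'
  have hM'' : ∀ t ∈ Set.Icc s T, ∀ a b, ‖U t a b - U' t a b‖ ≤ M' := fun t ht a b =>
    (((hM a b t ht).trans (le_abs_self _)).trans
      (Finset.single_le_sum (f := fun b => |M a b|) (fun _ _ => abs_nonneg _)
        (Finset.mem_univ b))).trans
      (Finset.single_le_sum (f := fun a => ∑ b, |M a b|)
        (fun _ _ => Finset.sum_nonneg fun _ _ => abs_nonneg _) (Finset.mem_univ a))
  -- The iterated bound holds for every `k` and tends to zero, which forces the two solutions to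
  -- coincide.
  have hlim : Filter.Tendsto (fun k : ℕ => M' * ((entryBound A * γ.arc s t) ^ k / k !))
      Filter.atTop (𝓝 (M' * 0)) :=
    (FloorSemiring.tendsto_pow_div_factorial_atTop _).const_mul _
  rw [mul_zero] at hlim
  have h0 : ‖U t a b - U' t a b‖ ≤ 0 := ge_of_tendsto' hlim fun k => by
    refine (hU.norm_sub_le hU' (by positivity) hM'' k ht a b).trans_eq ?_
    rw [mul_pow]
    ring
  exact sub_eq_zero.1 (norm_le_zero_iff.1 h0)

/-- The trace is a finite sum of entries, and reversal of words is a bijection that returns to the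
usual order. -/
theorem hasSum_normTrace_devSeries {s t : ℝ} (hst : s ≤ t) :
    HasSum (fun w => Complex.I ^ w.length * (γ.sig w s t : ℂ) * normTrace (matWord A w))
      (normTrace (devSeries γ A s t)) := by
  have h1 : HasSum (fun v => normTrace (devTerm γ A s v t)) (normTrace (devSeries γ A s t)) := by
    refine HasSum.mul_left _ ?_
    exact hasSum_sum fun a _ => (summable_devTerm γ A hst a a).hasSum
  have e : Function.Involutive (List.reverse : List (Fin d) → List (Fin d)) := List.reverse_reverse
  rw [← (e.toPerm _).hasSum_iff] at h1
  refine h1.congr_fun fun w => ?_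
  simp [devTerm, BVPath.sig]

end Development

end

noncomputable section

open scoped Nat Topology BigOperators

/-! ### Second moments of normalised traces of words -/

section SecondMoment

variable {d n m : ℕ}

theorem conj_normTrace (M : QubitMatrix n) :
    starRingEnd ℂ (normTrace M) = normTrace M.conjTranspose := by
  simp [normTrace, Matrix.trace_conjTranspose, Complex.conj_ofNat]

theorem conjTranspose_matWord {A : Fin d → QubitMatrix n} (hA : ∀ i, (A i).IsHermitian)
    (w : List (Fin d)) : (matWord A w).conjTranspose = matWord A w.reverse := by
  induction w with
  | nil => simp [matWord]
  | cons i w ih => rw [matWord_cons, Matrix.conjTranspose_mul, ih, hA i, matWord_reverse_cons]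

theorem pauliSums_isHermitian (x : Fin d × Fin m → SignedWord n) (i : Fin d) :
    (pauliSums x i).IsHermitian := by
  rw [pauliSums_eq, Matrix.IsHermitian, Matrix.conjTranspose_smul, Matrix.conjTranspose_sum]
  simp only [(signedPauli_isHermitian _).eq]
  simp

theorem sqrt_factorial_two_mul_le (k : ℕ) : √((2 * k)! : ℝ) ≤ 2 ^ k * k ! := by
  refine Real.sqrt_le_iff.2 ⟨by positivity, ?_⟩
  have h1 : (2 * k)! = k.centralBinom * k ! * k ! := by
    have h := Nat.choose_mul_factorial_mul_factorial (show k ≤ 2 * k by omega)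
    rw [show 2 * k - k = k by omega] at h
    exact h.symm
  have h2 : k.centralBinom ≤ 4 ^ k := by
    rw [Nat.centralBinom]
    refine (Nat.choose_le_two_pow _ _).trans_eq ?_
    rw [pow_mul]
    norm_num
  calc ((2 * k)! : ℝ) ≤ 4 ^ k * k ! * k ! := by
        rw [h1]
        exact_mod_cast Nat.mul_le_mul_right _ (Nat.mul_le_mul_right _ h2)
    _ = (2 ^ k * k !) ^ 2 := by
        rw [show (4 : ℝ) = 2 ^ 2 by norm_num, ← pow_mul, mul_comm 2 k, pow_mul]
        ring

/-- With `1 + 2k ≤ 3^k`, `1 + k ≤ 2^k` and `√((2k)!) ≤ 2^k k!`, the left side is at most `(54^k + 2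
· 16^k) k!`, which `4 · 64^k k!` dominates. The perfect square form is what Minkowski's inequality
needs. -/
theorem secondMoment_bound (k : ℕ) :
    (1 + (k + k : ℕ) : ℝ) ^ 3 * √((k + k)! : ℝ) + 2 * (2 ^ k * ((1 + k : ℝ) ^ 3 * √(k ! : ℝ))) ≤
      (2 * 8 ^ k * √(k ! : ℝ)) ^ 2 := by
  have h1 : (1 + (k + k : ℕ) : ℝ) ≤ 3 ^ k := by
    have := one_add_mul_le_pow (show (-2 : ℝ) ≤ 2 by norm_num) k
    norm_num at this
    push_cast
    linarith
  have h2 : (1 + k : ℝ) ≤ 2 ^ k := by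
    have := one_add_mul_le_pow (show (-2 : ℝ) ≤ 1 by norm_num) k
    norm_num at this
    linarith
  have h3 : √((k + k)! : ℝ) ≤ 2 ^ k * k ! := by
    rw [← two_mul]
    exact sqrt_factorial_two_mul_le k
  have h4 : √(k ! : ℝ) ≤ k ! := by
    refine Real.sqrt_le_iff.2 ⟨by positivity, ?_⟩
    have : (1 : ℝ) ≤ k ! := by exact_mod_cast Nat.one_le_iff_ne_zero.2 (Nat.factorial_ne_zero k)
    nlinarith
  have h5 : (54 : ℝ) ^ k ≤ 64 ^ k := pow_le_pow_left₀ (by norm_num) (by norm_num) k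
  have h6 : (16 : ℝ) ^ k ≤ 64 ^ k := pow_le_pow_left₀ (by norm_num) (by norm_num) k
  calc _ ≤ ((3 : ℝ) ^ k) ^ 3 * (2 ^ k * k !) + 2 * (2 ^ k * (((2 : ℝ) ^ k) ^ 3 * k !)) := by
        gcongr
    _ = (54 ^ k + 2 * 16 ^ k) * k ! := by
        rw [show (54 : ℝ) = 3 ^ 3 * 2 by norm_num, show (16 : ℝ) = 2 * 2 ^ 3 by norm_num]
        simp only [mul_pow, ← pow_mul, mul_comm k 3]
        ring
    _ ≤ (4 * 64 ^ k) * k ! := by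
        refine mul_le_mul_of_nonneg_right ?_ (by positivity)
        have : (0 : ℝ) ≤ 64 ^ k := by positivity
        linarith
    _ = _ := by
        rw [mul_pow, mul_pow, Real.sq_sqrt (by positivity), ← pow_mul, mul_comm k 2, pow_mul]
        norm_num

theorem expect_norm_normTrace_sub_sq_le (hm : 0 < m) (w : List (Fin d)) :
    (𝔼 x : Fin d × Fin m → SignedWord n,
      ‖normTrace (matWord (pauliSums x) w) - semicircularMoment w‖ ^ 2) ≤
      (2 * 8 ^ w.length * √(w.length ! : ℝ)) ^ 2 * ((m : ℝ)⁻¹ + ((4 : ℝ) ^ n)⁻¹) := by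
  set t := semicircularMoment w
  set ε := (m : ℝ)⁻¹ + ((4 : ℝ) ^ n)⁻¹ with hε
  have hε0 : 0 ≤ ε := by positivity
  -- Expand the square, using that conjugating a trace of Hermitian matrices reverses the word and
  -- that `t` is real. The multiples of `t * t` balance when each moment is centred at its free
  -- value.
  have e1 : ((𝔼 x : Fin d × Fin m → SignedWord n,
      ‖normTrace (matWord (pauliSums x) w) - t‖ ^ 2 : ℝ) : ℂ) =
      (traceMoment n m [w, w.reverse] - ([w, w.reverse].map semicircularMoment).prod) -
      t * ((traceMoment n m [w] - ([w].map semicircularMoment).prod) +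
        (traceMoment n m [w.reverse] - ([w.reverse].map semicircularMoment).prod)) := by
    have h : ∀ x : Fin d × Fin m → SignedWord n,
        ((‖normTrace (matWord (pauliSums x) w) - t‖ ^ 2 : ℝ) : ℂ) =
        normTrace (matWord (pauliSums x) w) * normTrace (matWord (pauliSums x) w.reverse) -
          t * (normTrace (matWord (pauliSums x) w) +
            normTrace (matWord (pauliSums x) w.reverse)) + t * t := by
      intro x
      have hc : starRingEnd ℂ t = t := conj_semicircularMoment w
      rw [Complex.ofReal_pow, ← Complex.mul_conj', map_sub, conj_normTrace,
        conjTranspose_matWord (pauliSums_isHermitian x), hc]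
      ring
    rw [Complex.ofReal_expect]
    simp only [h, traceMoment, List.map_cons, List.map_nil, List.prod_cons, List.prod_nil, mul_one,
      semicircularMoment_reverse, Finset.expect_add_distrib, Finset.expect_sub_distrib,
      ← Finset.mul_expect, Finset.expect_const Finset.univ_nonempty]
    ring
  have hb2 := norm_traceMoment_sub_prod_le (n := n) hm [w, w.reverse] (K := w.length + w.length)
    (by simp)
  have hb1 := norm_traceMoment_sub_prod_le (n := n) hm [w] (K := w.length) (by simp)
  have hb1' := norm_traceMoment_sub_prod_le (n := n) hm [w.reverse] (K := w.length) (by simp)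
  have ht : ‖t‖ ≤ 2 ^ w.length := norm_semicircularMoment_le w
  have h0 : 0 ≤ 𝔼 x : Fin d × Fin m → SignedWord n,
      ‖normTrace (matWord (pauliSums x) w) - t‖ ^ 2 :=
    Finset.expect_nonneg fun _ _ => by positivity
  rw [← Real.norm_of_nonneg h0, ← Complex.norm_real, e1]
  refine (norm_sub_le _ _).trans ?_
  rw [norm_mul]
  calc _ ≤ (1 + (w.length + w.length : ℕ) : ℝ) ^ 3 * √((w.length + w.length)! : ℝ) * ε +
        2 ^ w.length * ((1 + w.length : ℝ) ^ 3 * √(w.length ! : ℝ) * ε +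
          (1 + w.length : ℝ) ^ 3 * √(w.length ! : ℝ) * ε) := by
        refine add_le_add hb2 (mul_le_mul ht ((norm_add_le _ _).trans (add_le_add hb1 hb1'))
          (norm_nonneg _) (by positivity))
    _ = ((1 + (w.length + w.length : ℕ) : ℝ) ^ 3 * √((w.length + w.length)! : ℝ) +
        2 * (2 ^ w.length * ((1 + w.length : ℝ) ^ 3 * √(w.length ! : ℝ)))) * ε := by ring
    _ ≤ _ := mul_le_mul_of_nonneg_right (secondMoment_bound _) hε0

end SecondMoment

/-! ### Minkowski's inequality for finite averages of series -/

section Average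

variable {ι X : Type*} [Fintype X]

/-- Cauchy-Schwarz with weights `‖c i‖ * b i` gives Minkowski's bound while handling only squares.
-/
theorem expect_norm_sum_sq_le (s : Finset ι) {c : ι → ℂ} {Z : X → ι → ℂ} {b : ι → ℝ}
    (hb : ∀ i, 0 < b i) {ε : ℝ} (h : ∀ i, (𝔼 x, ‖Z x i‖ ^ 2) ≤ b i ^ 2 * ε) :
    (𝔼 x, ‖∑ i ∈ s, c i * Z x i‖ ^ 2) ≤ (∑ i ∈ s, ‖c i‖ * b i) ^ 2 * ε := by
  have h1 : ∀ x, ‖∑ i ∈ s, c i * Z x i‖ ^ 2 ≤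
      (∑ i ∈ s, ‖c i‖ * b i) * ∑ i ∈ s, ‖c i‖ / b i * ‖Z x i‖ ^ 2 := by
    intro x
    have h2 : ‖∑ i ∈ s, c i * Z x i‖ ≤ ∑ i ∈ s, ‖c i‖ * ‖Z x i‖ :=
      (norm_sum_le _ _).trans_eq (by simp)
    refine (pow_le_pow_left₀ (norm_nonneg _) h2 2).trans
      (Finset.sum_sq_le_sum_mul_sum_of_sq_le_mul s (fun i _ => ?_) (fun i _ => ?_)
        fun i _ => le_of_eq ?_)
    · have := hb i; positivity
    · have := hb i; positivity
    · have := (hb i).ne'; field_simp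
  refine (Finset.expect_le_expect fun x _ => h1 x).trans ?_
  rw [← Finset.mul_expect, Finset.expect_sum_comm, sq, mul_assoc]
  refine mul_le_mul_of_nonneg_left ?_ (Finset.sum_nonneg fun i _ => by have := hb i; positivity)
  rw [Finset.sum_mul]
  refine Finset.sum_le_sum fun i _ => ?_
  have hi := hb i
  rw [← Finset.mul_expect]
  refine (mul_le_mul_of_nonneg_left (h i) (by positivity)).trans_eq ?_
  field_simp

/-- The sample space is finite, so convergence at each point passes to the average and the bound on
partial sums survives the limit. -/
theorem expect_norm_sq_le_of_hasSum {c : ι → ℂ} {Z : X → ι → ℂ} {b a : ι → ℝ} {V : X → ℂ} {S : ℝ}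
    (hb : ∀ i, 0 < b i) {ε : ℝ} (hε : 0 ≤ ε) (h : ∀ i, (𝔼 x, ‖Z x i‖ ^ 2) ≤ b i ^ 2 * ε)
    (hV : ∀ x, HasSum (fun i => c i * Z x i) (V x)) (hc : ∀ i, ‖c i‖ * b i ≤ a i)
    (ha : HasSum a S) : (𝔼 x, ‖V x‖ ^ 2) ≤ S ^ 2 * ε := by
  have hlim : Filter.Tendsto (fun s : Finset ι => 𝔼 x, ‖∑ i ∈ s, c i * Z x i‖ ^ 2)
      Filter.atTop (𝓝 (𝔼 x, ‖V x‖ ^ 2)) := by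
    simp only [Fintype.expect_eq_sum_div_card]
    exact (tendsto_finsetSum _ fun x _ => ((hV x).norm.pow 2)).div_const _
  have h0 : ∀ i, 0 ≤ ‖c i‖ * b i := fun i => mul_nonneg (norm_nonneg _) (hb i).le
  refine le_of_tendsto' hlim fun s => (expect_norm_sum_sq_le s hb h).trans ?_
  refine mul_le_mul_of_nonneg_right (pow_le_pow_left₀ (Finset.sum_nonneg fun i _ => h0 i) ?_ 2) hε
  exact (Finset.sum_le_sum fun i _ => hc i).trans
    (sum_le_hasSum s (fun i _ => (h0 i).trans (hc i)) ha)

end Average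

/-! ### Independent samples from finite ensembles -/

/-- Independent uniform choices are one uniform choice of the whole family, so the joint law is a
uniform mixture of point masses. -/
theorem pi_map_uniformOfFintype {α E ι : Type*} [Fintype α] [Nonempty α] [Fintype ι] [DecidableEq ι]
    [MeasurableSpace E] (f : α → E) :
    Measure.pi (fun _ : ι => ((PMF.uniformOfFintype α).map f).toMeasure) =
      ∑ x : ι → α, (Fintype.card (ι → α) : ENNReal)⁻¹ • Measure.dirac fun i => f (x i) := by
  let _ : MeasurableSpace α := ⊤
  have hf : Measurable f := measurable_from_top
  have : DiscreteMeasurableSpace α := ⟨fun _ => trivial⟩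
  simp only [← PMF.toMeasure_map f _ hf]
  rw [← Measure.pi_map_pi fun _ => hf.aemeasurable,
    ← Measure.sum_smul_dirac (Measure.pi fun _ : ι => (PMF.uniformOfFintype α).toMeasure),
    Measure.sum_fintype, Measure.map_finset_sum (Measurable.of_discrete.aemeasurable)]
  refine Finset.sum_congr rfl fun x _ => ?_
  rw [Measure.map_smul, Measure.map_dirac' Measurable.of_discrete, Measure.pi_singleton]
  have hx : ∀ a : α, (PMF.uniformOfFintype α).toMeasure {a} = (Fintype.card α : ENNReal)⁻¹ :=
    fun a => by
      rw [PMF.toMeasure_apply_singleton _ _ (MeasurableSet.singleton a),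
        PMF.uniformOfFintype_apply]
  simp only [hx]
  simp [ENNReal.inv_pow]

/-- Finitely many point masses carry the law, so measurability of `F` is not needed. This spares a
proof that the development depends measurably on the matrices. -/
theorem integrable_and_integral_pi_uniform {α E ι : Type*} [Fintype α] [Nonempty α] [Fintype ι] [DecidableEq ι]
    [MeasurableSpace E] [MeasurableSingletonClass E] (f : α → E) (F : (ι → E) → ℝ) :
    Integrable F (Measure.pi fun _ : ι => ((PMF.uniformOfFintype α).map f).toMeasure) ∧
      ∫ y, F y ∂(Measure.pi fun _ : ι => ((PMF.uniformOfFintype α).map f).toMeasure) =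
        𝔼 x : ι → α, F fun i => f (x i) := by
  rw [pi_map_uniformOfFintype]
  have h : ∀ x ∈ (Finset.univ : Finset (ι → α)), Integrable F
      ((Fintype.card (ι → α) : ENNReal)⁻¹ • Measure.dirac fun i => f (x i)) := fun x _ =>
    (integrable_dirac (by simp)).smul_measure (by simp)
  refine ⟨integrable_finsetSum_measure.2 h, ?_⟩
  rw [integral_finsetSum_measure h, Fintype.expect_eq_sum_div_card, Finset.sum_div]
  refine Finset.sum_congr rfl fun x _ => ?_
  rw [integral_smul_measure, integral_dirac]
  simp [div_eq_inv_mul]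
end

noncomputable section

open scoped Nat Topology BigOperators

/-! ### The mean square distance between the two developments -/

/-- A bound for the signature coordinate of a word of length `k`, times a bound for the root mean
square error of its trace moment at `m⁻¹ + 4⁻ⁿ = 1`. -/
def wordBound (d : ℕ) (ℓ : ℝ) (k : ℕ) : ℝ :=
  (3 * d * ℓ) ^ k / k ! * (2 * 8 ^ k * √(k ! : ℝ))

/-- Write the term as `(2|x|)^k / √(k!)` times `2^{-k}` and bound the product by the sum of the
squares: an exponential series plus a geometric one. -/
theorem summable_pow_div_sqrt_factorial (x : ℝ) : Summable fun k : ℕ => x ^ k / √(k ! : ℝ) := by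
  have h : Summable fun k : ℕ => ((4 * x ^ 2) ^ k / k ! + (1 / 4 : ℝ) ^ k) :=
    (Real.summable_pow_div_factorial _).add
      (summable_geometric_of_lt_one (by norm_num) (by norm_num))
  refine Summable.of_norm_bounded h fun k => ?_
  have h1 : ‖x ^ k / √(k ! : ℝ)‖ = (2 * |x|) ^ k / √(k ! : ℝ) * (1 / 2) ^ k := by
    rw [norm_div, norm_pow, Real.norm_eq_abs, Real.norm_of_nonneg (Real.sqrt_nonneg _), mul_pow,
      div_pow, one_pow]
    field_simp
  have h2 : (4 * x ^ 2) ^ k / k ! = ((2 * |x|) ^ k / √(k ! : ℝ)) ^ 2 := by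
    rw [div_pow, Real.sq_sqrt (by positivity), ← pow_mul, mul_comm k 2, pow_mul, mul_pow 2 |x| 2,
      sq_abs]
    norm_num
  have h3 : (1 / 4 : ℝ) ^ k = ((1 / 2) ^ k) ^ 2 := by
    rw [← pow_mul, mul_comm k 2, pow_mul]
    norm_num
  rw [h1, h2, h3]
  nlinarith [sq_nonneg ((2 * |x|) ^ k / √(k ! : ℝ) - (1 / 2) ^ k),
    sq_nonneg ((2 * |x|) ^ k / √(k ! : ℝ)), sq_nonneg ((1 / 2 : ℝ) ^ k)]

theorem summable_wordBound (d : ℕ) (ℓ : ℝ) : Summable fun k => (d : ℝ) ^ k * wordBound d ℓ k := by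
  refine ((summable_pow_div_sqrt_factorial (d * (3 * d * ℓ) * 8)).mul_left 2).congr fun k => ?_
  rw [wordBound, mul_pow, mul_pow]
  have h : √(k ! : ℝ) ≠ 0 := (Real.sqrt_pos.2 (by positivity)).ne'
  have h' : (k ! : ℝ) ≠ 0 := by positivity
  field_simp
  rw [Real.sq_sqrt (by positivity)]

theorem BVPath.norm_sig_le {d : ℕ} {T : ℝ} (γ : BVPath d T) (w : List (Fin d)) {s t : ℝ}
    (hst : s ≤ t) : ‖γ.sig w s t‖ ≤ (3 * d * γ.length) ^ w.length / w.length ! := by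
  simpa [BVPath.sig] using γ.norm_sigRev_le' s w.reverse hst

theorem summable_gueTerm {d : ℕ} {T : ℝ} (γ : BVPath d T) {s t : ℝ} (hst : s ≤ t) :
    Summable (gueTerm γ s t) := by
  have h := (hasSum_length (d := d)
    (a := fun k => 2 ^ k * ((3 * d * γ.length) ^ k / k !)) (fun k => ?_) ?_).summable
  · refine Summable.of_norm_bounded h fun w => ?_
    rw [gueTerm, norm_mul, norm_mul, norm_pow, Complex.norm_I, one_pow, one_mul, Complex.norm_real]
    exact mul_le_mul (norm_semicircularMoment_le w) (γ.norm_sig_le w hst) (norm_nonneg _)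
      (by positivity)
  · have := γ.length_nonneg
    positivity
  · refine (Real.summable_pow_div_factorial (d * (2 * (3 * d * γ.length)))).congr fun k => ?_
    rw [mul_pow, mul_pow 2, mul_div_assoc, mul_div_assoc]

/-- Both developments are series over words with the same coefficients `i^{|w|} S^w`, so Minkowski's
inequality applies to their difference. -/
theorem expect_norm_normTrace_devSeries_sub_sq_le {d n m : ℕ} {T : ℝ} (γ : BVPath d T) {s t : ℝ}
    (hst : s ≤ t) (hm : 0 < m) :
    (𝔼 x : Fin d × Fin m → SignedWord n,
      ‖normTrace (devSeries γ (pauliSums x) s t) - gueDevelopment γ s t‖ ^ 2) ≤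
      (∑' k, (d : ℝ) ^ k * wordBound d γ.length k) ^ 2 * ((m : ℝ)⁻¹ + ((4 : ℝ) ^ n)⁻¹) := by
  have hℓ := γ.length_nonneg
  refine expect_norm_sq_le_of_hasSum
    (c := fun w : List (Fin d) => Complex.I ^ w.length * (γ.sig w s t : ℂ))
    (Z := fun x w => normTrace (matWord (pauliSums x) w) - semicircularMoment w)
    (b := fun w => 2 * 8 ^ w.length * √(w.length ! : ℝ))
    (a := fun w => wordBound d γ.length w.length) (fun w => ?_) (by positivity)
    (fun w => expect_norm_normTrace_sub_sq_le hm w) (fun x => ?_) (fun w => ?_)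
    (hasSum_length (fun k => ?_) (summable_wordBound d γ.length))
  · positivity
  · refine ((hasSum_normTrace_devSeries (γ := γ) (A := pauliSums x) hst).sub
      (summable_gueTerm γ hst).hasSum).congr_fun fun w => ?_
    simp only [gueTerm, semicircularMoment]
    ring
  · rw [norm_mul, norm_pow, Complex.norm_I, one_pow, one_mul, Complex.norm_real, wordBound]
    exact mul_le_mul_of_nonneg_right (γ.norm_sig_le w hst) (by positivity)
  · unfold wordBound; positivity

instance (n : ℕ) : MeasurableSingletonClass (QubitMatrix n) :=
  inferInstanceAs (MeasurableSingletonClass ((Fin n → Fin 2) → (Fin n → Fin 2) → ℂ))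

theorem integrable_and_integral_pauliEnsemble {d n m : ℕ} {Ω : Type*} [MeasurableSpace Ω]
    {P : Measure Ω} [IsProbabilityMeasure P] {A : Fin d → Ω → QubitMatrix n}
    (hA : ∀ ν, HasLaw (A ν) (randomPauliEnsemble n m) P) (hind : iIndepFun A P)
    (F : (Fin d → QubitMatrix n) → ℝ) :
    Integrable (fun ω => F fun ν => A ν ω) P ∧
      ∫ ω, F (fun ν => A ν ω) ∂P = 𝔼 x : Fin d × Fin m → SignedWord n, F (pauliSums x) := by
  have hm : AEMeasurable (fun ω ν => A ν ω) P :=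
    aemeasurable_pi_lambda _ fun ν => (hA ν).aemeasurable
  have hlaw : P.map (fun ω ν => A ν ω) =
      Measure.pi fun _ : Fin d => ((PMF.uniformOfFintype (Fin m → SignedWord n)).map
        pauliSum).toMeasure := by
    rw [(iIndepFun_iff_map_fun_eq_pi_map fun ν => (hA ν).aemeasurable).1 hind]
    congr 1
    exact funext fun ν => (hA ν).map_eq
  obtain ⟨h1, h2⟩ := integrable_and_integral_pi_uniform (ι := Fin d)
    (pauliSum : (Fin m → SignedWord n) → QubitMatrix n) F
  rw [← hlaw] at h1 h2
  refine ⟨h1.comp_aemeasurable hm, ?_⟩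
  rw [← integral_map hm h1.aestronglyMeasurable, h2]
  -- A family of `d` samples of `m` strings is one sample indexed by pairs of letter and colour.
  exact Fintype.expect_equiv (Equiv.curry (Fin d) (Fin m) (SignedWord n)).symm _ _ fun x => rfl
end

theorem mainTheorem3 :
    ∃ C : ℕ → ℝ → ℝ, (∀ d ℓ, 0 < C d ℓ) ∧
      ∀ (d : ℕ) (T : ℝ) (γ : BVPath d T) (s t : ℝ), 0 ≤ s → s ≤ t → t ≤ T →
        Summable (gueTerm γ s t) ∧
        ∀ (n m : ℕ), 0 < n → 0 < m →
        ∀ (Ω : Type*) [MeasurableSpace Ω] (P : Measure Ω) [IsProbabilityMeasure P]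
          (A : Fin d → Ω → QubitMatrix n),
          (∀ ν, HasLaw (A ν) (randomPauliEnsemble n m) P) → iIndepFun A P →
          (∀ ω, ∃ U : ℝ → QubitMatrix n, γ.IsDevelopment (fun ν => A ν ω) s U ∧
            ∀ U' : ℝ → QubitMatrix n, γ.IsDevelopment (fun ν => A ν ω) s U' →
              Set.EqOn U' U (Set.Icc s T)) ∧
          ∀ U : Ω → ℝ → QubitMatrix n, (∀ ω, γ.IsDevelopment (fun ν => A ν ω) s (U ω)) →
            Integrable (fun ω => ‖normTrace (U ω t) - gueDevelopment γ s t‖ ^ 2) P ∧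
            ∫ ω, ‖normTrace (U ω t) - gueDevelopment γ s t‖ ^ 2 ∂P <
              C d γ.length * ((m : ℝ)⁻¹ + ((4 : ℝ) ^ n)⁻¹) := by
  -- The added `1` makes the constant positive and the final inequality strict.
  refine ⟨fun d ℓ => (∑' k, (d : ℝ) ^ k * wordBound d ℓ k) ^ 2 + 1, fun d ℓ => by positivity, ?_⟩
  intro d T γ s t _ hst htT
  refine ⟨summable_gueTerm γ hst, fun n m hn hm Ω _ P _ A hA hind => ⟨fun ω => ?_, fun U hU => ?_⟩⟩
  · exact ⟨_, isDevelopment_devSeries γ _ s, fun U' hU' => hU'.eqOn (isDevelopment_devSeries γ _ s)⟩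
  -- Uniqueness at each `ω` makes any choice of solutions a function of the matrices alone, so only
  -- their joint law matters.
  · have h : ∀ ω, U ω t = devSeries γ (fun ν => A ν ω) s t := fun ω =>
      (hU ω).eqOn (isDevelopment_devSeries γ _ s) ⟨hst, htT⟩
    simp only [h]
    obtain ⟨h1, h2⟩ := integrable_and_integral_pauliEnsemble hA hind
      fun a => ‖normTrace (devSeries γ a s t) - gueDevelopment γ s t‖ ^ 2
    refine ⟨h1, ?_⟩
    rw [h2, add_mul, one_mul]
    exact (expect_norm_normTrace_devSeries_sub_sq_le γ hst hm).trans_lt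
      (lt_add_of_pos_right _ (by positivity))
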